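/- Let $\rho,p\in[0,1]$ and $L=10^6$. Let $\eta^x=(\eta^x_i)_{i\in\mathbb Z}$ and $\eta^y=(\eta^y_j)_{j\in\mathbb Z}$ be two independent sequences of i.i.d. random variables equal to $0$ with probability $\rho$ and to $1$ with probability $1-\rho$. The randomly stretched lattice $\mathcal G(\eta^x,\eta^y)$ is the graph with vertex set $\mathbb Z^2$ whose edges are the horizontal edges $\{(i,j),(i+1,j)\}$ with $\eta^y_j=1$ and the vertical edges $\{(i,j),(i,j+1)\}$ with $\eta^x_i=1$; that is, each vertical column and each horizontal row of edges of the square lattice is deleted independently with probability $\rho$. Given $(\eta^x,\eta^y)$, let each edge of $\mathcal G(\eta^x,\eta^y)$ be independently open with probability $p$ and closed with probability $1-p$, and let $\mathbb P$ be the annealed law, i.e. the law of the percolation process averaged over the environment $(\eta^x,\eta^y)$. If $$\rho\le L^{-16}\qquad\text{and}\qquad p\ge (1-L^{-10})^{1/4},$$ then $$\mathbb P\big[(0,0)\text{ is connected to infinity}\big]>0,$$ where $(0,0)$ is connected to infinity if its connected component in the graph of open edges is infinite. -/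

import Mathlib

open MeasureTheory

/-- The stretched lattice on `ℤ²` given by the sequences `ηx`, `ηy`: the horizontal edge
`{z, z + e₁}` is present iff the row of `z` is kept (`ηy z.2 = true`), and the vertical edge
`{z, z + e₂}` is present iff the column of `z` is kept (`ηx z.1 = true`). All vertices are kept. -/
def stretchedLattice (ηx ηy : ℤ → Bool) : SimpleGraph (ℤ × ℤ) :=
  SimpleGraph.fromEdgeSet
    ({e | ∃ z : ℤ × ℤ, ηy z.2 = true ∧ e = s(z, z + (1, 0))} ∪
     {e | ∃ z : ℤ × ℤ, ηx z.1 = true ∧ e = s(z, z + (0, 1))})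

/-- The law of one two-sided sequence: independent entries, each equal to `false` (the line is
deleted) with probability `ρ` and to `true` (the line is kept) with probability `1 - ρ`. -/
noncomputable def lineLaw (ρ : unitInterval) : Measure (ℤ → Bool) :=
  Measure.infinitePi fun _ : ℤ => ProbabilityTheory.bernoulliMeasure false true ρ

/-- The law of the environment `(ηx, ηy)`: two independent sequences. -/
noncomputable def environmentLaw (ρ : unitInterval) : Measure ((ℤ → Bool) × (ℤ → Bool)) :=
  (lineLaw ρ).prod (lineLaw ρ)

/-- Bernoulli bond percolation with parameter `p` on a graph `G`: the configurations are
the elements of `{0, 1}^E(G)`, and the edges are independently open (`true`) with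
probability `p` and closed (`false`) with probability `1 - p`. -/
noncomputable def bondPercolation {V : Type*} (G : SimpleGraph V) (p : unitInterval) :
    Measure (G.edgeSet → Bool) :=
  Measure.infinitePi fun _ : G.edgeSet => ProbabilityTheory.bernoulliMeasure true false p

/-- The spanning subgraph of `G` made of the open edges of a configuration. -/
def openGraph {V : Type*} (G : SimpleGraph V) (ω : G.edgeSet → Bool) : SimpleGraph V :=
  SimpleGraph.fromEdgeSet {e | ∃ h : e ∈ G.edgeSet, ω ⟨e, h⟩ = true}

/-- The vertex `v` is connected to infinity in `H`: its connected component is infinite. -/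
def ConnectedToInfinity {V : Type*} (H : SimpleGraph V) (v : V) : Prop :=
  {w : V | H.Reachable v w}.Infinite

/-- The annealed probability that the origin is connected to infinity: the quenched
probability, under Bernoulli bond percolation on the stretched lattice of the environment `η`,
averaged over `η`. -/
noncomputable def annealedPercolationProb (ρ p : unitInterval) : ENNReal :=
  ∫⁻ η, bondPercolation (stretchedLattice η.1 η.2) p
      {ω | ConnectedToInfinity (openGraph (stretchedLattice η.1 η.2) ω) (0, 0)}
    ∂(environmentLaw ρ)

/-! The proof is a multiscale renormalization in the quadrant. Lines are grouped into blocks of `2 ^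
(6 * D)` lines, where `D = labelDrop k` grows linearly in the scale `k`. Columns and rows carry
labels: 0 means good, and at scale 0 a deleted line has label 1. In passing to the next scale an
isolated defect of label `h` becomes `h - D`, so that small isolated defects disappear, while
several defects in one block add up with an extra `D` each.

Quenched part. A bond of scale `k + 1` joins consecutive good column blocks inside a good row block:
both end blocks contain a full row and a full column of scale-`k` bonds, and one full row runs
through both blocks and everything between them. Full rows and columns of a block cross, so bonds
really connect (`bond_conn`). The inductive claim `BondBound` is that a bond is open with
probability at least `(1 - 2 ^ (-8 * D)) * 2 ^ (-cost)`, where the cost of the defects between its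
ends is the sum of their labels, plus a penalty for each defect whose two neighbours are also
defects. By Harris' inequality a row through `M` blocks is full with probability at least `2 ^
(-e)`, where `e` is the sum of the block labels plus `M * (D + 1)`. A good row block has at most one
bad row, hence at least `2 ^ (6 * D - 1)` independent attempts at such a row. This gain pays for the
loss of `D` per block: adjacent good blocks are joined with overwhelming probability, and the
penalties cover long runs of bad blocks (`BondBound.succ`).

Environment. At each scale the labels are i.i.d., and the expectation of `2 ^ (14 * h)` over nonzero
labels `h` is at most `2 ^ (-(47 * D + 6))`. The coarse-graining preserves this bound
(`labelWeight_moment_succ`): isolated defects gain `2 ^ (-14 * D)`, and several defects contribute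
at second order. Hence with positive probability the initial blocks of rows and columns are good at
all scales (`lineLaw_goodLines_pos`).

In such an environment, with probability at least one half, the first row is full over the first
block and this block has a full row and column, at every scale (`originEvents_bound`); these events
chain the origin to vertices arbitrarily far away (`origin_conn`). -/

/-! ### Hierarchical bonds and the connections they give -/

/-- The drop of the label of an isolated defect from scale `k` to scale `k + 1`, which is also
the penalty for each of several defects in a block. -/
def labelDrop (k : ℕ) : ℕ := k + 6

/-- The number of blocks of scale `k` in a block of scale `k + 1`. -/
@[irreducible]
def blockSize (k : ℕ) : ℕ := 2 ^ (6 * labelDrop k)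

/-- Consecutive good indices of the interval `[a, c)` are joined by `b`. -/
def FullRow (x : ℕ → ℕ) (b : ℕ → ℕ → Prop) (a c : ℕ) : Prop :=
  ∀ i i', a ≤ i → i < i' → i' < c → x i = 0 → x i' = 0 →
    (∀ t, i < t → t < i' → x t ≠ 0) → b i i'

/-- Some good row of the block `J` of `N` rows is full over the columns `[a, c)`. -/
def HasRow (N : ℕ) (x y : ℕ → ℕ) (b : ℕ → ℕ → ℕ → Prop) (a c J : ℕ) : Prop :=
  ∃ j, N * J ≤ j ∧ j < N * J + N ∧ y j = 0 ∧ FullRow x (fun i i' => b i i' j) a c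

/-- The horizontal bond of scale `k` from column `I` to column `I'` in row `J`, for the column
labels `x`, the row labels `y`, the horizontal edges `u` and the vertical edges `v`. Vertical
bonds are obtained by transposition. -/
def Bond : ℕ → (ℕ → ℕ → ℕ) → (ℕ → ℕ → ℕ) → (ℕ → ℕ → Bool) → (ℕ → ℕ → Bool) →
    ℕ → ℕ → ℕ → Prop
  | 0, _, _, u, _, I, I', J => ∀ t, I ≤ t → t < I' → u t J = true
  | k + 1, x, y, u, v, I, I', J =>
    (∀ K, K = I ∨ K = I' →
      HasRow (blockSize k) (x k) (y k) (Bond k x y u v)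
        (blockSize k * K) (blockSize k * K + blockSize k) J ∧
      HasRow (blockSize k) (y k) (x k) (Bond k y x (fun a b => v b a) (fun a b => u b a))
        (blockSize k * J) (blockSize k * J + blockSize k) K) ∧
    HasRow (blockSize k) (x k) (y k) (Bond k x y u v)
      (blockSize k * I) (blockSize k * I' + blockSize k) J

/-- The block `(I, J)` of scale `k + 1` has a full row and a full column. -/
def Site (k : ℕ) (x y : ℕ → ℕ → ℕ) (u v : ℕ → ℕ → Bool) (I J : ℕ) : Prop :=
  HasRow (blockSize k) (x k) (y k) (Bond k x y u v)
    (blockSize k * I) (blockSize k * I + blockSize k) J ∧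
  HasRow (blockSize k) (y k) (x k) (Bond k y x (fun a b => v b a) (fun a b => u b a))
    (blockSize k * J) (blockSize k * J + blockSize k) I

lemma bond_succ_iff (k : ℕ) (x y : ℕ → ℕ → ℕ) (u v : ℕ → ℕ → Bool) (I I' J : ℕ) :
    Bond (k + 1) x y u v I I' J ↔ (Site k x y u v I J ∧ Site k x y u v I' J) ∧
      HasRow (blockSize k) (x k) (y k) (Bond k x y u v)
        (blockSize k * I) (blockSize k * I' + blockSize k) J := by
  rw [Bond]
  simp only [forall_eq_or_imp, forall_eq]
  rfl

lemma site_transpose {k : ℕ} {x y : ℕ → ℕ → ℕ} {u v : ℕ → ℕ → Bool} {I J : ℕ} :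
    Site k y x (fun a b => v b a) (fun a b => u b a) J I ↔ Site k x y u v I J :=
  and_comm

lemma FullRow.mono {x : ℕ → ℕ} {b : ℕ → ℕ → Prop} {a a' c c' : ℕ} (h : FullRow x b a c)
    (ha : a ≤ a') (hc : c' ≤ c) : FullRow x b a' c' :=
  fun i i' h1 h2 h3 => h i i' (ha.trans h1) h2 (h3.trans_le hc)

/-- Good sites of a full row are connected. -/
lemma FullRow.conn {V : Type*} {R : V → V → Prop} (hR : Equivalence R) {r : ℕ → V}
    {x : ℕ → ℕ} {b : ℕ → ℕ → Prop} {a c : ℕ} (h : FullRow x b a c)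
    (hb : ∀ i i', i < i' → x i = 0 → x i' = 0 → b i i' → R (r i) (r i')) :
    ∀ i i', a ≤ i → i < c → a ≤ i' → i' < c → x i = 0 → x i' = 0 → R (r i) (r i') := by
  have key : ∀ n i i', i' - i ≤ n → a ≤ i → i ≤ i' → i' < c → x i = 0 → x i' = 0 →
      R (r i) (r i') := by
    intro n
    induction n with
    | zero =>
      intro i i' h1 _ h3 _ _ _
      obtain rfl : i = i' := by omega
      exact hR.refl _
    | succ n ih =>
      intro i i' h1 h2 h3 h4 h5 h6
      by_cases hex : ∃ t, i < t ∧ t < i' ∧ x t = 0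
      · obtain ⟨t, ht1, ht2, ht3⟩ := hex
        exact hR.trans (ih i t (by omega) h2 ht1.le (by omega) h5 ht3)
          (ih t i' (by omega) (by omega) ht2.le h4 ht3 h6)
      · push Not at hex
        rcases h3.eq_or_lt with rfl | hlt
        · exact hR.refl _
        · exact hb i i' hlt h5 h6 (h i i' h2 hlt h4 h5 h6 hex)
  intro i i' h1 h2 h3 h4 h5 h6
  rcases le_total i i' with hle | hle
  · exact key _ i i' le_rfl h1 hle h4 h5 h6
  · exact hR.symm (key _ i' i le_rfl h3 hle h2 h6 h5)

/-- The position `p` is the crossing of a full row and a full column of the block `(I, J)`. -/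
def IsCrossing (k : ℕ) (x y : ℕ → ℕ → ℕ) (u v : ℕ → ℕ → Bool) (I J : ℕ) (p : ℕ × ℕ) : Prop :=
  (blockSize k * I ≤ p.1 ∧ p.1 < blockSize k * I + blockSize k ∧ x k p.1 = 0 ∧
    FullRow (y k) (fun j j' => Bond k y x (fun a b => v b a) (fun a b => u b a) j j' p.1)
      (blockSize k * J) (blockSize k * J + blockSize k)) ∧
  (blockSize k * J ≤ p.2 ∧ p.2 < blockSize k * J + blockSize k ∧ y k p.2 = 0 ∧
    FullRow (x k) (fun i i' => Bond k x y u v i i' p.2)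
      (blockSize k * I) (blockSize k * I + blockSize k))

lemma Site.exists_isCrossing {k : ℕ} {x y : ℕ → ℕ → ℕ} {u v : ℕ → ℕ → Bool} {I J : ℕ}
    (h : Site k x y u v I J) : ∃ p, IsCrossing k x y u v I J p := by
  obtain ⟨⟨j, hj⟩, ⟨i, hi⟩⟩ := h
  exact ⟨(i, j), hi, hj⟩

open Classical in
/-- A vertex in the main cluster of the block `(I, J)` of scale `k`. -/
noncomputable def blockVertex (x y : ℕ → ℕ → ℕ) (u v : ℕ → ℕ → Bool) : ℕ → ℕ → ℕ → ℕ × ℕ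
  | 0, I, J => (I, J)
  | k + 1, I, J =>
    if h : ∃ p, IsCrossing k x y u v I J p then
      blockVertex x y u v k h.choose.1 h.choose.2
    else blockVertex x y u v k (blockSize k * I) (blockSize k * J)

lemma two_le_blockSize (k : ℕ) : 2 ≤ blockSize k := by
  unfold blockSize labelDrop
  calc 2 = 2 ^ 1 := rfl
    _ ≤ _ := Nat.pow_le_pow_right (by norm_num) (by omega)

lemma blockVertex_fst_ge (x y : ℕ → ℕ → ℕ) (u v : ℕ → ℕ → Bool) (k I J : ℕ) :
    2 ^ k * I ≤ (blockVertex x y u v k I J).1 := by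
  induction k generalizing I J with
  | zero => simp [blockVertex]
  | succ k ih =>
    have key : ∀ i j, blockSize k * I ≤ i →
        2 ^ (k + 1) * I ≤ (blockVertex x y u v k i j).1 := by
      intro i j hi
      refine le_trans ?_ (ih i j)
      rw [pow_succ, mul_assoc]
      exact Nat.mul_le_mul_left _ ((Nat.mul_le_mul_right _ (two_le_blockSize k)).trans hi)
    rw [blockVertex]
    split_ifs with h
    · exact key _ _ h.choose_spec.1.1
    · exact key _ _ le_rfl

/-- The hypotheses under which bonds are connections: `R` connects the endpoints of open edges
in the lines that are kept. -/
structure Connects (R : ℕ × ℕ → ℕ × ℕ → Prop) (x y : ℕ → ℕ → ℕ) (u v : ℕ → ℕ → Bool) :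
    Prop where
  equiv : Equivalence R
  hor : ∀ i j, y 0 j = 0 → u i j = true → R (i, j) (i + 1, j)
  ver : ∀ i j, x 0 i = 0 → v i j = true → R (i, j) (i, j + 1)

lemma connects_of_edges {R : ℕ → ℕ → Prop} (hR : Equivalence R) {b : ℕ → Bool}
    (h : ∀ i, b i = true → R i (i + 1)) {i i' : ℕ} (hi : i ≤ i')
    (hb : ∀ t, i ≤ t → t < i' → b t = true) : R i i' := by
  induction i', hi using Nat.le_induction with
  | base => exact hR.refl _
  | succ n hn ih =>
    exact hR.trans (ih fun t h1 h2 => hb t h1 (by omega)) (h n (hb n hn (by omega)))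

/-- The inductive step of the connection: a bond of scale `k + 1` connects main vertices. -/
lemma bond_succ_conn {V : Type*} {R : V → V → Prop} (hR : Equivalence R) {k : ℕ}
    {x y : ℕ → ℕ → ℕ} {u v : ℕ → ℕ → Bool} {r r' : ℕ → ℕ → V}
    (hh : ∀ i i' j, i < i' → x k i = 0 → x k i' = 0 → y k j = 0 → Bond k x y u v i i' j →
      R (r i j) (r i' j))
    (hv : ∀ j j' i, j < j' → y k j = 0 → y k j' = 0 → x k i = 0 →
      Bond k y x (fun a b => v b a) (fun a b => u b a) j j' i → R (r i j) (r i j'))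
    (hr : ∀ I J, Site k x y u v I J →
      ∃ p : ℕ × ℕ, IsCrossing k x y u v I J p ∧ r' I J = r p.1 p.2)
    {I I' J : ℕ} (hI : I ≤ I') (hb : Bond (k + 1) x y u v I I' J) :
    R (r' I J) (r' I' J) := by
  rw [bond_succ_iff] at hb
  obtain ⟨⟨h1, h2⟩, j, hj1, hj2, hj3, hrow⟩ := hb
  obtain ⟨p, ⟨⟨a1, a2, a3, a4⟩, b1, b2, b3, -⟩, e1⟩ := hr _ _ h1
  obtain ⟨q, ⟨⟨c1, c2, c3, c4⟩, d1, d2, d3, -⟩, e2⟩ := hr _ _ h2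
  have hmul : blockSize k * I ≤ blockSize k * I' := Nat.mul_le_mul_left _ hI
  rw [e1, e2]
  -- The path follows the full column of the first block to the common row `j`, runs along `j`, and
  -- then follows the full column of the second block. The full rows of the two crossings are not
  -- needed.
  have s1 := a4.conn hR (r := fun j => r p.1 j)
    (fun i i' hi hi1 hi2 hi3 => hv i i' p.1 hi hi1 hi2 a3 hi3) p.2 j b1 b2 hj1 hj2 b3 hj3
  have s3 := c4.conn hR (r := fun j => r q.1 j)
    (fun i i' hi hi1 hi2 hi3 => hv i i' q.1 hi hi1 hi2 c3 hi3) j q.2 hj1 hj2 d1 d2 hj3 d3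
  have s2 := hrow.conn hR (r := fun i => r i j)
    (fun i i' hi hi1 hi2 hi3 => hh i i' j hi hi1 hi2 hj3 hi3) p.1 q.1 a1 (by omega) (by omega) c2
    a3 c3
  exact hR.trans s1 (hR.trans s2 s3)

lemma exists_isCrossing_blockVertex {k : ℕ} {x y : ℕ → ℕ → ℕ} {u v : ℕ → ℕ → Bool} {I J : ℕ}
    (h : Site k x y u v I J) : ∃ p : ℕ × ℕ, IsCrossing k x y u v I J p ∧
      blockVertex x y u v (k + 1) I J = blockVertex x y u v k p.1 p.2 := by
  have h' := h.exists_isCrossing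
  refine ⟨h'.choose, h'.choose_spec, ?_⟩
  rw [blockVertex, dif_pos h']

/-- Both directions are proved together, because a horizontal bond of the next scale uses full
columns. The vertical case is the horizontal one with the roles of rows and columns exchanged. -/
theorem bond_conn {R : ℕ × ℕ → ℕ × ℕ → Prop} {x y : ℕ → ℕ → ℕ} {u v : ℕ → ℕ → Bool}
    (hC : Connects R x y u v) (k : ℕ) :
    (∀ i i' j, i < i' → x k i = 0 → x k i' = 0 → y k j = 0 → Bond k x y u v i i' j →
      R (blockVertex x y u v k i j) (blockVertex x y u v k i' j)) ∧
    (∀ j j' i, j < j' → y k j = 0 → y k j' = 0 → x k i = 0 →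
      Bond k y x (fun a b => v b a) (fun a b => u b a) j j' i →
      R (blockVertex x y u v k i j) (blockVertex x y u v k i j')) := by
  have hR := hC.equiv
  induction k with
  | zero =>
    constructor
    · intro i i' j hi _ _ hj hb
      exact connects_of_edges (R := fun i i' => R (i, j) (i', j))
        ⟨fun _ => hR.refl _, hR.symm, hR.trans⟩ (b := fun t => u t j)
        (fun i => hC.hor i j hj) hi.le hb
    · intro j j' i hj _ _ hi hb
      exact connects_of_edges (R := fun j j' => R (i, j) (i, j'))
        ⟨fun _ => hR.refl _, hR.symm, hR.trans⟩ (b := fun t => v i t)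
        (fun j => hC.ver i j hi) hj.le hb
  | succ k ih =>
    constructor
    · intro I I' J hI _ _ _ hb
      exact bond_succ_conn hR ih.1 ih.2 (fun I J h => exists_isCrossing_blockVertex h) hI.le hb
    · intro J J' I hJ _ _ _ hb
      refine bond_succ_conn hR (r := fun j i => blockVertex x y u v k i j)
        (r' := fun j i => blockVertex x y u v (k + 1) i j)
        (fun j j' i => ih.2 j j' i) (fun i i' j => ih.1 i i' j) ?_ hJ.le hb
      intro J I h
      obtain ⟨p, hp, he⟩ := exists_isCrossing_blockVertex (site_transpose.1 h)
      exact ⟨p.swap, ⟨hp.2, hp.1⟩, he⟩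

/-- If the first row is full over the first block at all scales, the origin is connected to
vertices arbitrarily far away. -/
theorem origin_conn {R : ℕ × ℕ → ℕ × ℕ → Prop} {x y : ℕ → ℕ → ℕ} {u v : ℕ → ℕ → Bool}
    (hC : Connects R x y u v) (hx : ∀ k i, i < blockSize k → x k i = 0)
    (hy : ∀ k i, i < blockSize k → y k i = 0)
    (hs : ∀ k, Site k x y u v 0 0)
    (hf : ∀ k, FullRow (x k) (fun i i' => Bond k x y u v i i' 0) 0 (blockSize k)) (k : ℕ) :
    ∃ w : ℕ × ℕ, 2 ^ k ≤ w.1 ∧ R (0, 0) w := by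
  have hR := hC.equiv
  have hpos : ∀ k, 0 < blockSize k := fun k => by have := two_le_blockSize k; omega
  have hrow : ∀ k i i', i < blockSize k → i' < blockSize k →
      R (blockVertex x y u v k i 0) (blockVertex x y u v k i' 0) := by
    intro k i i' hi hi'
    exact (hf k).conn hR (r := fun i => blockVertex x y u v k i 0)
      (fun i i' h h1 h2 h3 => (bond_conn hC k).1 i i' 0 h h1 h2 (hy k 0 (hpos k)) h3) i i'
      (Nat.zero_le _) hi (Nat.zero_le _) hi' (hx k i hi) (hx k i' hi')
  have horigin : ∀ k, R (0, 0) (blockVertex x y u v k 0 0) := by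
    intro k
    induction k with
    | zero => exact hR.refl _
    | succ k ih =>
      refine hR.trans ih ?_
      obtain ⟨p, ⟨⟨a1, a2, a3, a4⟩, b1, b2, b3, -⟩, e⟩ := exists_isCrossing_blockVertex (hs k)
      simp only [mul_zero, zero_add] at a2 a4 b2
      -- The main vertex of the next scale lies at the crossing `p`: row 0 leads to column `p.1`,
      -- and that full column leads up to `p.2`.
      rw [e]
      refine hR.trans (hrow k 0 p.1 (hpos k) a2) ?_
      exact a4.conn hR (r := fun j => blockVertex x y u v k p.1 j)
        (fun j j' h h1 h2 h3 => (bond_conn hC k).2 j j' p.1 h h1 h2 a3 h3) 0 p.2 le_rfl (hpos k)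
        (Nat.zero_le _) b2 (hy k 0 (hpos k)) b3
  refine ⟨blockVertex x y u v k 1 0, by simpa using blockVertex_fst_ge x y u v k 1 0, ?_⟩
  exact hR.trans (horigin k) (hrow k 0 1 (hpos k) (two_le_blockSize k))

/-! ### Increasing and local events of a product measure -/

section LocalEvents

variable {E : Type*}

/-- The event `A` depends only on the coordinates in `F`. -/
def LocalOn (F : Finset E) (A : Set (E → Bool)) : Prop :=
  ∀ ω ω' : E → Bool, (∀ e ∈ F, ω e = ω' e) → ω ∈ A → ω' ∈ A

/-- The event `A` is increasing and depends only on the coordinates in `F`. -/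
def IncrOn (F : Finset E) (A : Set (E → Bool)) : Prop :=
  ∀ ω ω' : E → Bool, (∀ e ∈ F, ω e ≤ ω' e) → ω ∈ A → ω' ∈ A

lemma IncrOn.localOn {F : Finset E} {A : Set (E → Bool)} (h : IncrOn F A) : LocalOn F A :=
  fun ω ω' hω => h ω ω' fun e he => (hω e he).le

lemma IncrOn.mono {F G : Finset E} {A : Set (E → Bool)} (h : IncrOn F A) (hFG : F ⊆ G) :
    IncrOn G A :=
  fun ω ω' hω => h ω ω' fun e he => hω e (hFG he)

lemma LocalOn.compl {F : Finset E} {A : Set (E → Bool)} (h : LocalOn F A) : LocalOn F Aᶜ :=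
  fun ω ω' hω h1 h2 => h1 (h ω' ω (fun e he => (hω e he).symm) h2)

lemma IncrOn.inter {F : Finset E} {A B : Set (E → Bool)} (hA : IncrOn F A) (hB : IncrOn F B) :
    IncrOn F (A ∩ B) :=
  fun ω ω' hω h => ⟨hA ω ω' hω h.1, hB ω ω' hω h.2⟩

open Classical in
/-- A configuration on `F` extended by `false`. -/
noncomputable def extendConfig (F : Finset E) (z : F → Bool) : E → Bool :=
  fun e => if h : e ∈ F then z ⟨e, h⟩ else false

lemma LocalOn.eq_preimage {F : Finset E} {A : Set (E → Bool)} (h : LocalOn F A) :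
    A = F.restrict ⁻¹' {z | extendConfig F z ∈ A} := by
  ext ω
  have hω : ∀ e ∈ F, ω e = extendConfig F (F.restrict ω) e := by
    intro e he
    simp [extendConfig, he]
  exact ⟨h _ _ hω, h _ _ fun e he => (hω e he).symm⟩

lemma LocalOn.measurableSet {F : Finset E} {A : Set (E → Bool)} (h : LocalOn F A) :
    MeasurableSet A := by
  rw [h.eq_preimage]
  exact Finset.measurable_restrict F (Set.toFinite _).measurableSet

variable (ν : Measure Bool) [IsProbabilityMeasure ν]

lemma LocalOn.measureReal_eq {F : Finset E} {A : Set (E → Bool)} (h : LocalOn F A) :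
    (Measure.infinitePi fun _ : E => ν).real A =
      (Measure.pi fun _ : F => ν).real {z | extendConfig F z ∈ A} := by
  conv_lhs => rw [h.eq_preimage]
  rw [← Measure.infinitePi_map_restrict (μ := fun _ : E => ν),
    map_measureReal_apply (Finset.measurable_restrict F) (Set.toFinite _).measurableSet]

/-- Harris' inequality. -/
theorem IncrOn.harris {F : Finset E} {A B : Set (E → Bool)} (hA : IncrOn F A) (hB : IncrOn F B) :
    (Measure.infinitePi fun _ : E => ν).real A * (Measure.infinitePi fun _ : E => ν).real B ≤
      (Measure.infinitePi fun _ : E => ν).real (A ∩ B) := by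
  classical
  rw [hA.localOn.measureReal_eq ν, hB.localOn.measureReal_eq ν,
    (hA.inter hB).localOn.measureReal_eq ν]
  set m := Measure.pi fun _ : F => ν with hm
  have hsum : ∀ S : Set (F → Bool), m.real S = ∑ z, m.real {z} * S.indicator 1 z := by
    intro S
    have hS : S = ((Finset.univ.filter (· ∈ S) : Finset (F → Bool)) : Set (F → Bool)) := by
      ext; simp
    conv_lhs => rw [hS, ← sum_measureReal_singleton, Finset.sum_filter]
    refine Finset.sum_congr rfl fun z _ => ?_
    by_cases hz : z ∈ S <;> simp [hz]
  have hsing : ∀ z : F → Bool, m.real {z} = ∏ i, ν.real {z i} := by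
    intro z
    simp [measureReal_def, hm, Measure.pi_singleton, ENNReal.toReal_prod]
  have hmono : ∀ S : Set (E → Bool), IncrOn F S →
      Monotone (({z : F → Bool | extendConfig F z ∈ S}).indicator (1 : (F → Bool) → ℝ)) := by
    intro S hS z z' hz
    by_cases h1 : extendConfig F z ∈ S
    · have h2 : extendConfig F z' ∈ S := by
        refine hS _ _ (fun e he => ?_) h1
        simpa [extendConfig, he] using hz ⟨e, he⟩
      simp [h1, h2]
    · rw [Set.indicator_of_notMem (by simpa using h1)]
      exact Set.indicator_nonneg (fun _ _ => zero_le_one) _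
  have hnn : ∀ S : Set (F → Bool), 0 ≤ S.indicator (1 : (F → Bool) → ℝ) :=
    fun S z => Set.indicator_nonneg (fun _ _ => zero_le_one) _
  have key := fkg (μ := fun z : F → Bool => m.real {z}) _ _ (fun z => measureReal_nonneg)
    (hnn {z | extendConfig F z ∈ A}) (hnn {z | extendConfig F z ∈ B}) (hmono A hA) (hmono B hB)
    (by
      intro a b
      -- The lattice condition is an equality for a product measure: in each coordinate the meet and
      -- join are the two original values, up to order.
      refine le_of_eq ?_
      simp only [hsing, ← Finset.prod_mul_distrib]
      refine Finset.prod_congr rfl fun i _ => ?_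
      simp only [Pi.inf_apply, Pi.sup_apply]
      rcases le_total (a i) (b i) with h | h
      · rw [inf_eq_left.2 h, sup_eq_right.2 h]
      · rw [inf_eq_right.2 h, sup_eq_left.2 h, mul_comm])
  have hone : ∑ z : F → Bool, m.real {z} = 1 := by
    rw [sum_measureReal_singleton]
    simp [hm]
  rw [hone, one_mul] at key
  rw [hsum, hsum, hsum]
  refine key.trans (le_of_eq (Finset.sum_congr rfl fun z _ => ?_))
  by_cases h1 : extendConfig F z ∈ A <;> by_cases h2 : extendConfig F z ∈ B <;> simp [h1, h2]

lemma LocalOn.measureReal_inter {F G : Finset E} (hFG : Disjoint F G) {A B : Set (E → Bool)}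
    (hA : LocalOn F A) (hB : LocalOn G B) :
    (Measure.infinitePi fun _ : E => ν).real (A ∩ B) =
      (Measure.infinitePi fun _ : E => ν).real A * (Measure.infinitePi fun _ : E => ν).real B := by
  have hind := ProbabilityTheory.iIndepFun_infinitePi (P := fun _ : E => ν)
    (X := fun _ b => b) (fun _ => measurable_id)
  have h2 := hind.indepFun_finset F G hFG (fun i => measurable_pi_apply i)
  rw [ProbabilityTheory.indepFun_iff_measure_inter_preimage_eq_mul] at h2
  have h3 := h2 {z | extendConfig F z ∈ A} {z | extendConfig G z ∈ B}
    (Set.toFinite _).measurableSet (Set.toFinite _).measurableSet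
  have eA : (fun (ω : E → Bool) (i : F) => ω i) ⁻¹' {z | extendConfig F z ∈ A} = A :=
    hA.eq_preimage.symm
  have eB : (fun (ω : E → Bool) (i : G) => ω i) ⁻¹' {z | extendConfig G z ∈ B} = B :=
    hB.eq_preimage.symm
  rw [eA, eB] at h3
  rw [measureReal_def, h3, ENNReal.toReal_mul]
  rfl

/-- Independent attempts: some of the local events `A j` with disjoint supports occurs. -/
lemma measureReal_exists_ge {ι : Type*} (R : Finset ι) (F : ι → Finset E)
    (A : ι → Set (E → Bool)) (hA : ∀ j ∈ R, LocalOn (F j) (A j))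
    (hF : (R : Set ι).PairwiseDisjoint F) {q : ℝ}
    (hq : ∀ j ∈ R, q ≤ (Measure.infinitePi fun _ : E => ν).real (A j)) :
    1 - Real.exp (-(q * R.card)) ≤
      (Measure.infinitePi fun _ : E => ν).real {ω | ∃ j ∈ R, ω ∈ A j} := by
  classical
  set μ := Measure.infinitePi fun _ : E => ν
  have hloc : ∀ R' ⊆ R, LocalOn (R'.biUnion F) {ω | ∀ j ∈ R', ω ∉ A j} := by
    intro R' hR' ω ω' hω h j hj
    exact (hA j (hR' hj)).compl ω ω' (fun e he => hω e (Finset.mem_biUnion.2 ⟨j, hj, he⟩)) (h j hj)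
  have key : ∀ R' ⊆ R, μ.real {ω | ∀ j ∈ R', ω ∉ A j} ≤ Real.exp (-(q * R'.card)) := by
    intro R'
    induction R' using Finset.induction_on with
    | empty => intro _; simp [μ]
    | insert j R' hj ih =>
      intro hR'
      have hjR : j ∈ R := hR' (Finset.mem_insert_self _ _)
      have hsub : R' ⊆ R := fun a ha => hR' (Finset.mem_insert_of_mem ha)
      have hset : {ω | ∀ i ∈ insert j R', ω ∉ A i} = (A j)ᶜ ∩ {ω | ∀ i ∈ R', ω ∉ A i} := by
        ext ω; simp
      have hdisj : Disjoint (F j) (R'.biUnion F) := by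
        rw [Finset.disjoint_biUnion_right]
        intro i hi
        exact hF hjR (hsub hi) fun h => hj (h ▸ hi)
      rw [hset, LocalOn.measureReal_inter ν hdisj (hA j hjR).compl (hloc R' hsub),
        Finset.card_insert_of_notMem hj]
      push_cast
      rw [mul_add, neg_add, add_comm, Real.exp_add, mul_one]
      refine mul_le_mul ?_ (ih hsub) measureReal_nonneg (Real.exp_pos _).le
      rw [probReal_compl_eq_one_sub (hA j hjR).measurableSet]
      have := Real.add_one_le_exp (-q)
      linarith [hq j hjR]
  have hcompl : {ω | ∃ j ∈ R, ω ∈ A j} = {ω | ∀ j ∈ R, ω ∉ A j}ᶜ := by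
    ext ω; simp
  rw [hcompl, probReal_compl_eq_one_sub (hloc R subset_rfl).measurableSet]
  linarith [key R subset_rfl]

end LocalEvents

/-! ### Monotonicity and support of bonds -/

/-- The side length of a block of scale `k`. -/
def scaleLength : ℕ → ℕ
  | 0 => 1
  | k + 1 => scaleLength k * blockSize k

/-- The configuration `(u, v)` is below `(u', v')` on the edges based in `[a, c) × [b, d)`. -/
def ConfigLE (a c b d : ℕ) (u v u' v' : ℕ → ℕ → Bool) : Prop :=
  ∀ s t, a ≤ s → s < c → b ≤ t → t < d → u s t ≤ u' s t ∧ v s t ≤ v' s t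

lemma ConfigLE.mono {a c b d a' c' b' d' : ℕ} {u v u' v' : ℕ → ℕ → Bool}
    (h : ConfigLE a c b d u v u' v') (h1 : a ≤ a') (h2 : c' ≤ c) (h3 : b ≤ b') (h4 : d' ≤ d) :
    ConfigLE a' c' b' d' u v u' v' :=
  fun s t g1 g2 g3 g4 => h s t (h1.trans g1) (g2.trans_le h2) (h3.trans g3) (g4.trans_le h4)

lemma ConfigLE.transpose {a c b d : ℕ} {u v u' v' : ℕ → ℕ → Bool}
    (h : ConfigLE a c b d u v u' v') :
    ConfigLE b d a c (fun s t => v t s) (fun s t => u t s) (fun s t => v' t s)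
      (fun s t => u' t s) :=
  fun s t g1 g2 g3 g4 => (h t s g3 g4 g1 g2).symm

/-- Bonds of scale `k` depend monotonically on the edges based in the blocks they run through. -/
def BondMono (k : ℕ) : Prop :=
  ∀ (x y : ℕ → ℕ → ℕ) (u v u' v' : ℕ → ℕ → Bool) (i i' j : ℕ), i ≤ i' →
    ConfigLE (scaleLength k * i) (scaleLength k * (i' + 1)) (scaleLength k * j)
      (scaleLength k * (j + 1)) u v u' v' →
    Bond k x y u v i i' j → Bond k x y u' v' i i' j

lemma BondMono.fullRow {k : ℕ} (hk : BondMono k) {x y : ℕ → ℕ → ℕ} {z : ℕ → ℕ}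
    {u v u' v' : ℕ → ℕ → Bool} {a c j : ℕ}
    (h : ConfigLE (scaleLength k * a) (scaleLength k * c) (scaleLength k * j)
      (scaleLength k * (j + 1)) u v u' v')
    (hf : FullRow z (fun i i' => Bond k x y u v i i' j) a c) :
    FullRow z (fun i i' => Bond k x y u' v' i i' j) a c := by
  intro i i' h1 h2 h3 h4 h5 h6
  exact hk x y u v u' v' i i' j h2.le (h.mono (Nat.mul_le_mul_left _ h1)
    (Nat.mul_le_mul_left _ h3) le_rfl le_rfl) (hf i i' h1 h2 h3 h4 h5 h6)

lemma BondMono.hasRow {k : ℕ} (hk : BondMono k) {x y : ℕ → ℕ → ℕ} {z w : ℕ → ℕ}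
    {u v u' v' : ℕ → ℕ → Bool} {N a c J : ℕ}
    (h : ConfigLE (scaleLength k * a) (scaleLength k * c) (scaleLength k * (N * J))
      (scaleLength k * (N * J + N)) u v u' v')
    (hf : HasRow N z w (Bond k x y u v) a c J) :
    HasRow N z w (Bond k x y u' v') a c J := by
  obtain ⟨j, h1, h2, h3, h4⟩ := hf
  exact ⟨j, h1, h2, h3, hk.fullRow (h.mono le_rfl le_rfl (Nat.mul_le_mul_left _ h1)
    (Nat.mul_le_mul_left _ h2)) h4⟩

lemma BondMono.site {k : ℕ} (hk : BondMono k) {x y : ℕ → ℕ → ℕ}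
    {u v u' v' : ℕ → ℕ → Bool} {I J : ℕ}
    (h : ConfigLE (scaleLength (k + 1) * I) (scaleLength (k + 1) * (I + 1))
      (scaleLength (k + 1) * J) (scaleLength (k + 1) * (J + 1)) u v u' v')
    (hf : Site k x y u v I J) : Site k x y u' v' I J := by
  simp only [scaleLength, mul_assoc, mul_add_one] at h
  exact ⟨hk.hasRow (by simpa only [mul_add] using h) hf.1,
    hk.hasRow (by simpa only [mul_add] using h.transpose) hf.2⟩

/-- Monotonicity is what Harris' inequality needs. The support, confined to the strip of row `j`,
makes full rows with different `j` independent. -/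
theorem bondMono (k : ℕ) : BondMono k := by
  induction k with
  | zero =>
    intro x y u v u' v' i i' j hi h hb t h1 h2
    have := (h t j (by simpa [scaleLength] using h1) (by simp [scaleLength]; omega)
      (by simp [scaleLength]) (by simp [scaleLength])).1
    rw [hb t h1 h2] at this
    exact top_le_iff.1 this
  | succ k ih =>
    intro x y u v u' v' I I' J hI h hb
    rw [bond_succ_iff] at hb ⊢
    refine ⟨⟨ih.site (h.mono le_rfl ?_ le_rfl le_rfl) hb.1.1,
      ih.site (h.mono ?_ le_rfl le_rfl le_rfl) hb.1.2⟩, ih.hasRow ?_ hb.2⟩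
    · exact Nat.mul_le_mul_left _ (by omega)
    · exact Nat.mul_le_mul_left _ hI
    · simp only [scaleLength, mul_assoc, mul_add_one] at h
      simpa only [mul_add] using h

/-! ### Labels and crossing costs -/

/-- The label of a block of labels `h`. An isolated defect loses `labelDrop k`, several defects
are summed with a penalty. -/
def coarseLabel (k : ℕ) (h : Fin (blockSize k) → ℕ) : ℕ :=
  if (Finset.univ.filter fun r => h r ≠ 0).card ≤ 1 then (∑ r, h r) - labelDrop k
  else ∑ r, if h r = 0 then 0 else h r + labelDrop k

/-- The labels of scale `k + 1` are the coarse labels of the blocks of scale `k`. -/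
def Hierarchical (x : ℕ → ℕ → ℕ) : Prop :=
  ∀ k I, x (k + 1) I = coarseLabel k fun r => x k (blockSize k * I + r)

/-- The exponential cost of crossing the index `t`. -/
def crossCost (k : ℕ) (h : ℕ → ℕ) (t : ℕ) : ℕ :=
  h t + if h (t - 1) ≠ 0 ∧ h t ≠ 0 ∧ h (t + 1) ≠ 0 then labelDrop k else 0

lemma sum_Ico_block (f : ℕ → ℕ) (a N : ℕ) :
    ∑ t ∈ Finset.Ico a (a + N), f t = ∑ r : Fin N, f (a + r) := by
  rw [Finset.sum_Ico_eq_sum_range, Nat.add_sub_cancel_left, Finset.sum_range]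

lemma card_le_one_of_label_eq_zero {k : ℕ} {h : Fin (blockSize k) → ℕ}
    (h0 : coarseLabel k h = 0) : (Finset.univ.filter fun r => h r ≠ 0).card ≤ 1 := by
  by_contra hc
  rw [coarseLabel, if_neg hc] at h0
  apply hc
  rw [Finset.card_eq_zero.2 ?_]
  · exact zero_le_one
  · rw [Finset.filter_eq_empty_iff]
    intro r _
    have := (Finset.sum_eq_zero_iff.1 h0) r (Finset.mem_univ _)
    split_ifs at this with h1
    · simp [h1]
    · omega

/-- The labels are designed for this bound. A lone defect pays no penalty and its label drops by at
most `labelDrop k`; with several defects the block label already contains every possible penalty. -/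
lemma sum_crossCost_block {x : ℕ → ℕ → ℕ} (hx : Hierarchical x) (k I : ℕ) :
    ∑ t ∈ Finset.Ico (blockSize k * I) (blockSize k * I + blockSize k), crossCost k (x k) t ≤
      x (k + 1) I + labelDrop k := by
  rw [sum_Ico_block, hx k I, coarseLabel]
  have hN := two_le_blockSize k
  split_ifs with hc
  · have : ∀ r : Fin (blockSize k), crossCost k (x k) (blockSize k * I + r) =
        x k (blockSize k * I + r) := by
      intro r
      rw [crossCost, if_neg, add_zero]
      rintro ⟨h1, h2, h3⟩
      rw [Finset.card_le_one] at hc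
      -- A penalty needs defects on both sides, and one neighbour lies in the block. For `r = 0` it
      -- is the right one: the left one is in the previous block, or is the index itself by
      -- truncated subtraction.
      rcases Nat.eq_zero_or_pos r.1 with hr | hr
      · have := hc r (by simpa using h2) ⟨r + 1, by omega⟩
          (by simpa [add_assoc] using h3)
        have := congrArg Fin.val this
        simp at this
      · have := hc r (by simpa using h2) ⟨r - 1, by omega⟩
          (by simpa [Nat.add_sub_assoc hr] using h1)
        have := congrArg Fin.val this
        simp at this
        omega
    simp only [this]
    omega
  · refine le_trans (Finset.sum_le_sum fun r _ => ?_) (Nat.le_add_right _ _)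
    rw [crossCost]
    split_ifs <;> simp_all

lemma sum_crossCost_blocks {x : ℕ → ℕ → ℕ} (hx : Hierarchical x) (k I M : ℕ) :
    ∑ t ∈ Finset.Ico (blockSize k * I) (blockSize k * (I + M)), crossCost k (x k) t ≤
      ∑ b ∈ Finset.Ico I (I + M), x (k + 1) b + M * labelDrop k := by
  induction M with
  | zero => simp
  | succ M ih =>
    rw [← add_assoc, Finset.sum_Ico_succ_top (by omega),
      ← Finset.sum_Ico_consecutive (n := blockSize k * (I + M)) _
        (Nat.mul_le_mul_left _ (by omega)) (Nat.mul_le_mul_left _ (by omega))]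
    have := sum_crossCost_block hx k (I + M)
    rw [← mul_add_one] at this
    rw [add_one_mul]
    omega

/-- A run of defects of scale `k` pays the penalty for all but the two extreme ones. -/
lemma le_sum_crossCost_run (k : ℕ) {h : ℕ → ℕ} {I I' : ℕ}
    (hbad : ∀ t, I < t → t < I' → h t ≠ 0) :
    ∑ b ∈ Finset.Ioo I I', h b + (I' - I - 3) * labelDrop k ≤
      ∑ b ∈ Finset.Ioo I I', crossCost k h b := by
  simp only [crossCost, Finset.sum_add_distrib]
  refine Nat.add_le_add_left ?_ _
  have hsub : Finset.Ico (I + 2) (I' - 1) ⊆ Finset.Ioo I I' := by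
    intro t ht
    simp only [Finset.mem_Ico, Finset.mem_Ioo] at ht ⊢
    omega
  refine le_trans ?_ (Finset.sum_le_sum_of_subset hsub)
  rw [Finset.sum_congr rfl (g := fun _ => labelDrop k)]
  · simp only [Finset.sum_const, Nat.card_Ico, smul_eq_mul]
    exact Nat.mul_le_mul_right _ (by omega)
  · intro t ht
    simp only [Finset.mem_Ico] at ht
    rw [if_pos ⟨hbad _ (by omega) (by omega), hbad _ (by omega) (by omega),
      hbad _ (by omega) (by omega)⟩]

/-- A good block has at most one bad line. -/
lemma card_good_lines {y : ℕ → ℕ → ℕ} (hy : Hierarchical y) {k J : ℕ} (hJ : y (k + 1) J = 0) :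
    blockSize k ≤ ((Finset.Ico (blockSize k * J) (blockSize k * J + blockSize k)).filter
      fun j => y k j = 0).card + 1 := by
  rw [hy] at hJ
  have h1 := card_le_one_of_label_eq_zero hJ
  have h2 : (Finset.univ.filter fun r : Fin (blockSize k) =>
      y k (blockSize k * J + r) ≠ 0).card =
      ((Finset.Ico (blockSize k * J) (blockSize k * J + blockSize k)).filter
        fun j => ¬ y k j = 0).card := by
    rw [Finset.card_filter, Finset.card_filter, sum_Ico_block]
  have h3 := Finset.card_filter_add_card_filter_not
    (s := Finset.Ico (blockSize k * J) (blockSize k * J + blockSize k)) (fun j => y k j = 0)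
  rw [Nat.card_Ico] at h3
  omega

/-! ### Bond probabilities for fixed labels -/

section Quenched

/-- The horizontal edges of a configuration on the edges of the quadrant. -/
def hor (ω : ℕ × ℕ × Bool → Bool) (a b : ℕ) : Bool := ω (a, b, true)

/-- The vertical edges of a configuration on the edges of the quadrant. -/
def ver (ω : ℕ × ℕ × Bool → Bool) (a b : ℕ) : Bool := ω (a, b, false)

/-- The reflection of a configuration in the diagonal. -/
def reflect (ω : ℕ × ℕ × Bool → Bool) : ℕ × ℕ × Bool → Bool :=
  fun e => ω (e.2.1, e.1, !e.2.2)

/-- The edges based in `[a, c) × [b, d)`. -/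
def edgeBox (a c b d : ℕ) : Finset (ℕ × ℕ × Bool) :=
  Finset.Ico a c ×ˢ Finset.Ico b d ×ˢ Finset.univ

lemma configLE_of_edgeBox {a c b d : ℕ} {ω ω' : ℕ × ℕ × Bool → Bool}
    (h : ∀ e ∈ edgeBox a c b d, ω e ≤ ω' e) :
    ConfigLE a c b d (hor ω) (ver ω) (hor ω') (ver ω') := by
  intro s t h1 h2 h3 h4
  exact ⟨h _ (by simp [edgeBox, *]), h _ (by simp [edgeBox, *])⟩

/-- The event that a bond is open. -/
def bondEvent (k : ℕ) (x y : ℕ → ℕ → ℕ) (i i' j : ℕ) : Set (ℕ × ℕ × Bool → Bool) :=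
  {ω | Bond k x y (hor ω) (ver ω) i i' j}

/-- The event that a row is full. -/
def rowEvent (k : ℕ) (x y : ℕ → ℕ → ℕ) (a c j : ℕ) : Set (ℕ × ℕ × Bool → Bool) :=
  {ω | FullRow (x k) (fun i i' => Bond k x y (hor ω) (ver ω) i i' j) a c}

/-- The event that a block of rows contains a full one. -/
def hasRowEvent (k : ℕ) (x y : ℕ → ℕ → ℕ) (a c J : ℕ) : Set (ℕ × ℕ × Bool → Bool) :=
  {ω | HasRow (blockSize k) (x k) (y k) (Bond k x y (hor ω) (ver ω)) a c J}

lemma bondEvent_incrOn (k : ℕ) (x y : ℕ → ℕ → ℕ) {i i' : ℕ} (j : ℕ) (hi : i ≤ i') :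
    IncrOn (edgeBox (scaleLength k * i) (scaleLength k * (i' + 1)) (scaleLength k * j)
      (scaleLength k * (j + 1))) (bondEvent k x y i i' j) :=
  fun _ _ hω h => bondMono k x y _ _ _ _ i i' j hi (configLE_of_edgeBox hω) h

lemma rowEvent_incrOn (k : ℕ) (x y : ℕ → ℕ → ℕ) (a c j : ℕ) :
    IncrOn (edgeBox (scaleLength k * a) (scaleLength k * c) (scaleLength k * j)
      (scaleLength k * (j + 1))) (rowEvent k x y a c j) :=
  fun _ _ hω h => (bondMono k).fullRow (configLE_of_edgeBox hω) h

lemma hasRowEvent_incrOn (k : ℕ) (x y : ℕ → ℕ → ℕ) (a c J : ℕ) :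
    IncrOn (edgeBox (scaleLength k * a) (scaleLength k * c) (scaleLength k * (blockSize k * J))
      (scaleLength k * (blockSize k * J + blockSize k))) (hasRowEvent k x y a c J) :=
  fun _ _ hω h => (bondMono k).hasRow (configLE_of_edgeBox hω) h

variable (ν : Measure Bool) [IsProbabilityMeasure ν]

/-- The percolation measure on the quadrant. -/
noncomputable def quadrantLaw : Measure (ℕ × ℕ × Bool → Bool) := Measure.infinitePi fun _ => ν

instance : IsProbabilityMeasure (quadrantLaw ν) := by
  unfold quadrantLaw; infer_instance

lemma harris_exists {E : Type*} {A B : Set (E → Bool)} (hA : ∃ F, IncrOn F A)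
    (hB : ∃ F, IncrOn F B) :
    (Measure.infinitePi fun _ : E => ν).real A * (Measure.infinitePi fun _ : E => ν).real B ≤
      (Measure.infinitePi fun _ : E => ν).real (A ∩ B) := by
  classical
  obtain ⟨F, hF⟩ := hA
  obtain ⟨G, hG⟩ := hB
  exact (hF.mono Finset.subset_union_left).harris ν (hG.mono Finset.subset_union_right)

lemma incrOn_exists_inter {E : Type*} {A B : Set (E → Bool)} (hA : ∃ F, IncrOn F A)
    (hB : ∃ F, IncrOn F B) : ∃ F, IncrOn F (A ∩ B) := by
  classical
  obtain ⟨F, hF⟩ := hA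
  obtain ⟨G, hG⟩ := hB
  exact ⟨_, (hF.mono Finset.subset_union_left).inter (hG.mono Finset.subset_union_right)⟩

lemma reflect_preimage_incrOn {A : Set (ℕ × ℕ × Bool → Bool)} (hA : ∃ F, IncrOn F A) :
    ∃ F, IncrOn F (reflect ⁻¹' A) := by
  classical
  obtain ⟨F, hF⟩ := hA
  refine ⟨F.image fun e => (e.2.1, e.1, !e.2.2), fun ω ω' hω h => hF _ _ (fun e he => ?_) h⟩
  exact hω _ (Finset.mem_image_of_mem _ he)

lemma measureReal_reflect_preimage {A : Set (ℕ × ℕ × Bool → Bool)} (hA : ∃ F, IncrOn F A) :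
    (quadrantLaw ν).real (reflect ⁻¹' A) = (quadrantLaw ν).real A := by
  obtain ⟨F, hF⟩ := hA
  have hinj : Function.Injective fun e : ℕ × ℕ × Bool => (e.2.1, e.1, !e.2.2) := by
    rintro ⟨a, b, c⟩ ⟨a', b', c'⟩ h
    simp only [Prod.mk.injEq, Bool.not_eq_eq_eq_not, Bool.not_not] at h
    ext <;> simp_all
  have := Measure.map_infinitePi_infinitePi_of_inj (P := fun _ : ℕ × ℕ × Bool => ν) hinj
  conv_rhs => rw [quadrantLaw, ← this]
  rw [map_measureReal_apply (by fun_prop) hF.localOn.measurableSet]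
  rfl

/-- The failure probability of a bond of scale `k` between adjacent good columns. -/
noncomputable def bondError (k : ℕ) : ℝ := (1 / 2) ^ (8 * labelDrop k)

lemma bondError_pos (k : ℕ) : 0 < bondError k := by unfold bondError; positivity

lemma bondError_le_one (k : ℕ) : bondError k ≤ 1 :=
  pow_le_one₀ (by norm_num) (by norm_num)

/-- Bonds of scale `k` are open with the expected probability. -/
def BondBound (k : ℕ) : Prop :=
  ∀ x y : ℕ → ℕ → ℕ, Hierarchical x → Hierarchical y → ∀ i i' j, i < i' →
    x k i = 0 → x k i' = 0 → y k j = 0 → (∀ t, i < t → t < i' → x k t ≠ 0) →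
    (1 - bondError k) * (1 / 2) ^ (∑ t ∈ Finset.Ioo i i', crossCost k (x k) t) ≤
      (quadrantLaw ν).real (bondEvent k x y i i' j)

/-- When column `c` is bad, or is the first good one, no pair of consecutive good columns ends at
`c`. -/
lemma rowEvent_succ_of_bad {k : ℕ} {x y : ℕ → ℕ → ℕ} {a c j : ℕ}
    (h : ∀ i, a ≤ i → i < c → x k i = 0 → x k c ≠ 0) :
    rowEvent k x y a c j ⊆ rowEvent k x y a (c + 1) j := by
  intro ω hω i i' h1 h2 h3 h4 h5 h6
  rcases (Nat.lt_succ_iff.1 h3).lt_or_eq with h7 | rfl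
  · exact hω i i' h1 h2 h7 h4 h5 h6
  · exact absurd h5 (h i h1 h2 h4)

variable {ν}

/-- A full row is an intersection of increasing bond events, one per pair of consecutive good
columns. The runs of defects between them are disjoint, so their costs add up to at most the total
cost. -/
lemma BondBound.row {k : ℕ} (hk : BondBound ν k) {x y : ℕ → ℕ → ℕ} (hx : Hierarchical x)
    (hy : Hierarchical y) {j : ℕ} (hj : y k j = 0) (a n : ℕ) :
    (1 - bondError k) ^ n *
        (1 / 2) ^ (∑ t ∈ Finset.Ico a (a + n), crossCost k (x k) t) ≤
      (quadrantLaw ν).real (rowEvent k x y a (a + n) j) := by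
  have hU0 := bondError_pos k
  have hU1 := bondError_le_one k
  induction n using Nat.strong_induction_on with
  | _ n ih =>
  rcases n with _ | n
  · have : rowEvent k x y a (a + 0) j = Set.univ := by
      refine Set.eq_univ_of_forall fun ω i i' h1 h2 h3 => ?_
      omega
    rw [this]
    simp
  by_cases hgood : ∃ i, a ≤ i ∧ i < a + n ∧ x k i = 0 ∧ x k (a + n) = 0
  · obtain ⟨i₀, hi1, hi2, hi3, hn⟩ := hgood
    obtain ⟨m, hm⟩ : ∃ m, m < n ∧ x k (a + m) = 0 ∧ ∀ t, a + m < t → t < a + n → x k t ≠ 0 := by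
      classical
      have hP : ∃ m, m ≤ n ∧ x k (a + m) = 0 ∧ m < n := ⟨i₀ - a, by omega, by
        rwa [Nat.add_sub_cancel' hi1], by omega⟩
      obtain ⟨w, hw1, hw2, hw3⟩ := hP
      have hspec := Nat.findGreatest_spec (P := fun m => x k (a + m) = 0 ∧ m < n) hw1 ⟨hw2, hw3⟩
      refine ⟨_, hspec.2, hspec.1, fun t ht1 ht2 ht3 => ?_⟩
      refine Nat.findGreatest_is_greatest (P := fun m => x k (a + m) = 0 ∧ m < n)
        (k := t - a) (n := n) (by omega) (by omega) ⟨?_, by omega⟩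
      rwa [Nat.add_sub_cancel' (by omega)]
    obtain ⟨hm1, hm2, hm3⟩ := hm
    have h1 := ih (m + 1) (by omega)
    have h2 := hk x y hx hy (a + m) (a + n) j (by omega) hm2 hn hj hm3
    have hsub : rowEvent k x y a (a + (m + 1)) j ∩ bondEvent k x y (a + m) (a + n) j ⊆
        rowEvent k x y a (a + (n + 1)) j := by
      rintro ω ⟨hω1, hω2⟩ i i' g1 g2 g3 g4 g5 g6
      by_cases hlt : i' < a + (m + 1)
      · exact hω1 i i' g1 g2 hlt g4 g5 g6
      · have e1 : i' = a + n := by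
          by_contra hne
          exact hm3 i' (by omega) (by omega) g5
        have e2 : i = a + m := by
          rcases lt_trichotomy i (a + m) with h | h | h
          · exact absurd hm2 (g6 _ h (by omega))
          · exact h
          · exact absurd g4 (hm3 i h (by omega))
        subst e1 e2
        exact hω2
    refine le_trans ?_ (measureReal_mono hsub)
    refine le_trans ?_ (harris_exists ν ⟨_, rowEvent_incrOn k x y a _ j⟩
      ⟨_, bondEvent_incrOn k x y j (show a + m ≤ a + n by omega)⟩)
    refine le_trans ?_ (mul_le_mul h1 h2 (by have := sub_nonneg.2 hU1; positivity)
      measureReal_nonneg)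
    have hs : ∑ t ∈ Finset.Ico a (a + (m + 1)), crossCost k (x k) t +
        ∑ t ∈ Finset.Ioo (a + m) (a + n), crossCost k (x k) t ≤
        ∑ t ∈ Finset.Ico a (a + (n + 1)), crossCost k (x k) t := by
      rw [← Finset.sum_union]
      · refine Finset.sum_le_sum_of_subset fun t ht => ?_
        simp only [Finset.mem_union, Finset.mem_Ico, Finset.mem_Ioo] at ht ⊢
        omega
      · rw [Finset.disjoint_left]
        intro t ht
        simp only [Finset.mem_Ico, Finset.mem_Ioo] at ht ⊢
        omega
    rw [mul_mul_mul_comm, ← pow_succ, ← pow_add]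
    refine mul_le_mul ?_ ?_ (by positivity) (by have := sub_nonneg.2 hU1; positivity)
    · exact pow_le_pow_of_le_one (by linarith) (by linarith) (by omega)
    · exact pow_le_pow_of_le_one (by norm_num) (by norm_num) hs
  · push Not at hgood
    refine le_trans ?_ ((ih n (by omega)).trans
      (measureReal_mono (rowEvent_succ_of_bad hgood)))
    refine mul_le_mul ?_ ?_ (by positivity) (by have := sub_nonneg.2 hU1; positivity)
    · exact pow_le_pow_of_le_one (by linarith) (by linarith) (by omega)
    · refine pow_le_pow_of_le_one (by norm_num) (by norm_num) ?_
      exact Finset.sum_le_sum_of_subset (Finset.Ico_subset_Ico_right (by omega))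

/-- By Bernoulli's inequality the bond errors of a whole block cost at most a factor one half, since
`blockSize k * bondError k = 2 ^ (-2 * labelDrop k)`. -/
lemma one_sub_bondError_pow_ge (k M : ℕ) :
    (1 / 2 : ℝ) ^ M ≤ (1 - bondError k) ^ (blockSize k * M) := by
  rw [pow_mul]
  refine pow_le_pow_left₀ (by norm_num) ?_ _
  have h := one_add_mul_le_pow (a := -bondError k) (by linarith [bondError_le_one k])
    (blockSize k)
  have h2 : (blockSize k : ℝ) * bondError k ≤ 1 / 2 := by
    unfold blockSize bondError
    push_cast
    rw [show 8 * labelDrop k = 6 * labelDrop k + 2 * labelDrop k by ring, pow_add, ← mul_assoc,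
      ← mul_pow]
    norm_num
    refine (pow_le_pow_of_le_one (by norm_num) (by norm_num)
      (show 1 ≤ 2 * labelDrop k by unfold labelDrop; omega)).trans (by norm_num)
  rw [← sub_eq_add_neg] at h
  linarith

/-- The probability that one of the rows of a good block is full. -/
lemma BondBound.hasRow {k : ℕ} (hk : BondBound ν k) {x y : ℕ → ℕ → ℕ} (hx : Hierarchical x)
    (hy : Hierarchical y) {J : ℕ} (hJ : y (k + 1) J = 0) (I M e : ℕ)
    (he : ∑ b ∈ Finset.Ico I (I + M), x (k + 1) b + M * (labelDrop k + 1) ≤ e) :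
    1 - Real.exp (-((1 / 2) ^ e * 2 ^ (6 * labelDrop k - 1))) ≤
      (quadrantLaw ν).real
        (hasRowEvent k x y (blockSize k * I) (blockSize k * (I + M)) J) := by
  set R := (Finset.Ico (blockSize k * J) (blockSize k * J + blockSize k)).filter
      fun j => y k j = 0
  have hrow : ∀ j ∈ R, (1 / 2 : ℝ) ^ e ≤ (quadrantLaw ν).real
      (rowEvent k x y (blockSize k * I) (blockSize k * (I + M)) j) := by
    intro j hj
    have h1 := hk.row hx hy (Finset.mem_filter.1 hj).2 (blockSize k * I) (blockSize k * M)
    rw [← mul_add] at h1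
    refine le_trans ?_ h1
    refine le_trans ?_ (mul_le_mul_of_nonneg_right (one_sub_bondError_pow_ge k M)
      (by positivity))
    rw [← pow_add]
    refine pow_le_pow_of_le_one (by norm_num) (by norm_num) ?_
    have := sum_crossCost_blocks hx k I M
    rw [mul_add_one] at he
    omega
  have hdisj : (R : Set ℕ).PairwiseDisjoint fun j => edgeBox (scaleLength k * (blockSize k * I))
      (scaleLength k * (blockSize k * (I + M))) (scaleLength k * j) (scaleLength k * (j + 1)) := by
    have hlt : ∀ j j', j < j' → scaleLength k * (j + 1) ≤ scaleLength k * j' :=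
      fun j j' h => Nat.mul_le_mul_left _ h
    intro j _ j' _ hne
    rw [Function.onFun, Finset.disjoint_left]
    intro e he he'
    simp only [edgeBox, Finset.mem_product, Finset.mem_Ico] at he he'
    rcases lt_or_gt_of_ne hne with h | h
    · have := hlt _ _ h; omega
    · have := hlt _ _ h; omega
  have key := measureReal_exists_ge ν R _ _ (fun j _ => (rowEvent_incrOn k x y
    (blockSize k * I) (blockSize k * (I + M)) j).localOn) hdisj hrow
  have hset : {ω | ∃ j ∈ R, ω ∈ rowEvent k x y (blockSize k * I) (blockSize k * (I + M)) j} =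
      hasRowEvent k x y (blockSize k * I) (blockSize k * (I + M)) J := by
    ext ω
    simp only [R, hasRowEvent, HasRow, Finset.mem_filter, Finset.mem_Ico, Set.mem_ofPred_eq,
      and_assoc, rowEvent]
  rw [hset] at key
  refine le_trans ?_ key
  refine sub_le_sub_left (Real.exp_le_exp.2 (neg_le_neg ?_)) _
  refine mul_le_mul_of_nonneg_left ?_ (by positivity)
  have hcard : blockSize k ≤ R.card + 1 := card_good_lines hy hJ
  -- At most one row is bad, so at least half of the rows are available.
  have hN : blockSize k = 2 ^ (6 * labelDrop k - 1) + 2 ^ (6 * labelDrop k - 1) := by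
    rw [← two_mul, ← pow_succ', blockSize, Nat.sub_add_cancel (by unfold labelDrop; omega)]
  have hpos : 1 ≤ 2 ^ (6 * labelDrop k - 1) := Nat.one_le_two_pow
  have : 2 ^ (6 * labelDrop k - 1) ≤ R.card := by omega
  exact_mod_cast this

/-- The error of the events in a good block. -/
noncomputable def siteError (k : ℕ) : ℝ := Real.exp (-2 ^ (4 * labelDrop k - 3))

lemma five_mul_siteError_le (k : ℕ) : 5 * siteError k ≤ bondError (k + 1) := by
  have hD : 6 ≤ labelDrop k := by unfold labelDrop; omega
  have h := Real.pow_div_factorial_le_exp ((2 : ℝ) ^ (4 * labelDrop k - 3)) (by positivity) 4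
  rw [siteError, Real.exp_neg, bondError, show labelDrop (k + 1) = labelDrop k + 1 by
    unfold labelDrop; omega]
  have h24 : ((Nat.factorial 4 : ℕ) : ℝ) = 24 := by norm_num [Nat.factorial]
  rw [h24, ← pow_mul] at h
  rw [one_div, inv_pow, ← div_eq_mul_inv, div_le_iff₀ (Real.exp_pos _)]
  rw [inv_mul_eq_div, le_div_iff₀ (by positivity)]
  refine le_trans ?_ h
  rw [le_div_iff₀ (by norm_num)]
  -- The 7 comes from `5 * 4! = 120 ≤ 2 ^ 7`, with `exp z ≥ z ^ 4 / 4!`.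
  have : (2 : ℝ) ^ (7 + 8 * (labelDrop k + 1)) ≤ 2 ^ ((4 * labelDrop k - 3) * 4) :=
    pow_le_pow_right₀ (by norm_num) (by omega)
  rw [pow_add] at this
  have h3 : (0 : ℝ) < 2 ^ (8 * (labelDrop k + 1)) := by positivity
  nlinarith

lemma siteError_pos (k : ℕ) : 0 < siteError k := Real.exp_pos _

lemma siteError_le (k : ℕ) : siteError k ≤ 1 / 100 := by
  have h1 := five_mul_siteError_le k
  have h2 : bondError (k + 1) ≤ (1 / 2) ^ 8 :=
    pow_le_pow_of_le_one (by norm_num) (by norm_num) (by unfold labelDrop; omega)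
  norm_num at h2
  linarith

/-- The threshold is the exponent for a row through two good blocks. -/
lemma exp_le_siteError {k e : ℕ} (he : e ≤ 2 * labelDrop k + 2) :
    Real.exp (-((1 / 2) ^ e * 2 ^ (6 * labelDrop k - 1))) ≤ siteError k := by
  have hD : 6 ≤ labelDrop k := by unfold labelDrop; omega
  refine Real.exp_le_exp.2 (neg_le_neg ?_)
  rw [show 6 * labelDrop k - 1 = (4 * labelDrop k - 3) + (2 * labelDrop k + 2) by omega, pow_add,
    one_div, inv_pow, mul_left_comm, inv_mul_eq_div]
  refine le_mul_of_one_le_right (by positivity) ?_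
  rw [one_le_div (by positivity)]
  exact pow_le_pow_right₀ (by norm_num) he

/-- The event that a block has a full row and a full column. -/
def siteEvent (k : ℕ) (x y : ℕ → ℕ → ℕ) (I J : ℕ) : Set (ℕ × ℕ × Bool → Bool) :=
  {ω | Site k x y (hor ω) (ver ω) I J}

lemma siteEvent_eq (k : ℕ) (x y : ℕ → ℕ → ℕ) (I J : ℕ) :
    siteEvent k x y I J =
      hasRowEvent k x y (blockSize k * I) (blockSize k * (I + 1)) J ∩
        reflect ⁻¹' hasRowEvent k y x (blockSize k * J) (blockSize k * (J + 1)) I :=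
  rfl

lemma siteEvent_incr (k : ℕ) (x y : ℕ → ℕ → ℕ) (I J : ℕ) :
    ∃ F, IncrOn F (siteEvent k x y I J) :=
  incrOn_exists_inter ⟨_, hasRowEvent_incrOn k x y _ _ _⟩
    (reflect_preimage_incrOn ⟨_, hasRowEvent_incrOn k y x _ _ _⟩)

lemma BondBound.site {k : ℕ} (hk : BondBound ν k) {x y : ℕ → ℕ → ℕ} (hx : Hierarchical x)
    (hy : Hierarchical y) {I J : ℕ} (hI : x (k + 1) I = 0) (hJ : y (k + 1) J = 0) :
    (1 - siteError k) ^ 2 ≤ (quadrantLaw ν).real (siteEvent k x y I J) := by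
  have key : ∀ {x y : ℕ → ℕ → ℕ}, Hierarchical x → Hierarchical y → ∀ {I J : ℕ},
      x (k + 1) I = 0 → y (k + 1) J = 0 → 1 - siteError k ≤ (quadrantLaw ν).real
        (hasRowEvent k x y (blockSize k * I) (blockSize k * (I + 1)) J) := by
    intro x y hx hy I J hI hJ
    have h1 := hk.hasRow hx hy hJ I 1 (labelDrop k + 1) (by simp [hI])
    have h2 := exp_le_siteError (k := k) (e := labelDrop k + 1) (by omega)
    linarith
  have hs : 0 ≤ 1 - siteError k := by linarith [siteError_le k]
  rw [siteEvent_eq, pow_two]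
  refine le_trans ?_ (harris_exists ν ⟨_, hasRowEvent_incrOn k x y _ _ _⟩
    (reflect_preimage_incrOn ⟨_, hasRowEvent_incrOn k y x _ _ _⟩))
  refine mul_le_mul (key hx hy hI hJ) ?_ hs measureReal_nonneg
  refine (key hy hx hJ hI).trans (le_of_eq ?_)
  exact (measureReal_reflect_preimage ν ⟨_, hasRowEvent_incrOn k y x _ _ _⟩).symm

/-- The two end blocks require four rows or columns, each failing with probability at most
`siteError k`. Harris' inequality separates them from the long row. -/
lemma BondBound.succ_aux {k : ℕ} (hk : BondBound ν k) {x y : ℕ → ℕ → ℕ} (hx : Hierarchical x)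
    (hy : Hierarchical y) {I I' J : ℕ} (hI : x (k + 1) I = 0) (hI' : x (k + 1) I' = 0)
    (hJ : y (k + 1) J = 0) :
    (1 - 4 * siteError k) * (quadrantLaw ν).real
        (hasRowEvent k x y (blockSize k * I) (blockSize k * (I' + 1)) J) ≤
      (quadrantLaw ν).real (bondEvent (k + 1) x y I I' J) := by
  have hset : bondEvent (k + 1) x y I I' J =
      (siteEvent k x y I J ∩ siteEvent k x y I' J) ∩
        hasRowEvent k x y (blockSize k * I) (blockSize k * (I' + 1)) J := by
    ext ω
    exact bond_succ_iff k x y _ _ I I' J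
  have hs0 := siteError_pos k
  have hs1 := siteError_le k
  rw [hset]
  refine le_trans ?_ (harris_exists ν (incrOn_exists_inter (siteEvent_incr k x y I J)
    (siteEvent_incr k x y I' J)) ⟨_, hasRowEvent_incrOn k x y _ _ _⟩)
  refine mul_le_mul_of_nonneg_right ?_ measureReal_nonneg
  refine le_trans ?_ (harris_exists ν (siteEvent_incr k x y I J) (siteEvent_incr k x y I' J))
  refine le_trans ?_ (mul_le_mul (hk.site hx hy hI hJ) (hk.site hx hy hI' hJ) (by positivity)
    measureReal_nonneg)
  have := one_add_mul_le_pow (a := -siteError k) (by linarith) 4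
  push_cast at this
  nlinarith

/-- Without a bad block between the ends, five events of error `siteError k` give the bound.
Otherwise the many attempts make the long row more likely than `2 ^ (-T)` by a constant factor,
which absorbs the end blocks. -/
lemma BondBound.succ {k : ℕ} (hk : BondBound ν k) : BondBound ν (k + 1) := by
  intro x y hx hy I I' J hII hI hI' hJ hbad
  have hs0 := siteError_pos k
  have hs1 := siteError_le k
  have hD : 6 ≤ labelDrop k := by unfold labelDrop; omega
  have hD' : labelDrop (k + 1) = labelDrop k + 1 := by unfold labelDrop; omega
  refine le_trans ?_ (hk.succ_aux hx hy hI hI' hJ)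
  obtain ⟨m, rfl⟩ : ∃ m, I' = I + 1 + m := ⟨I' - I - 1, by omega⟩
  have hsum : ∑ b ∈ Finset.Ico I (I + (m + 2)), x (k + 1) b =
      ∑ b ∈ Finset.Ioo I (I + 1 + m), x (k + 1) b := by
    rw [show I + (m + 2) = (I + 1 + m) + 1 by ring, Finset.sum_Ico_succ_top (by omega), hI',
      add_zero, Finset.sum_eq_sum_Ico_succ_bot (by omega), hI, zero_add]
    rfl
  have hrow := hk.hasRow hx hy hJ I (m + 2) _ le_rfl
  rw [hsum, show I + (m + 2) = (I + 1 + m) + 1 by ring] at hrow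
  set S := ∑ b ∈ Finset.Ioo I (I + 1 + m), x (k + 1) b with hS
  rcases Nat.eq_zero_or_pos m with rfl | hm
  · have hS0 : S = 0 := by simp [hS]
    have h2 := exp_le_siteError (k := k) (e := S + (0 + 2) * (labelDrop k + 1)) (by omega)
    have h5 := five_mul_siteError_le k
    have he : ∑ t ∈ Finset.Ioo I (I + 1 + 0), crossCost (k + 1) (x (k + 1)) t = 0 := by simp
    rw [he, pow_zero, mul_one]
    have h6 : 1 - siteError k ≤ _ := (sub_le_sub_left h2 1).trans hrow
    refine le_trans ?_ (mul_le_mul_of_nonneg_left h6 (by linarith))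
    nlinarith
  · have hrun := le_sum_crossCost_run (k + 1) hbad
    rw [← hS, hD'] at hrun
    set T := ∑ t ∈ Finset.Ioo I (I + 1 + m), crossCost (k + 1) (x (k + 1)) t with hT
    have hS1 : 1 ≤ S := by
      have h1 : I + 1 ∈ Finset.Ioo I (I + 1 + m) := by simp; omega
      have h2 := Finset.single_le_sum (f := fun b => x (k + 1) b) (fun _ _ => Nat.zero_le _) h1
      have h3 := hbad (I + 1) (by omega) (by omega)
      simp only [← hS] at h2
      omega
    -- The run pays `m - 2` penalties of `labelDrop k + 1` in `T`, so at most four remain uncovered;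
    -- `4 * (D + 1) + 5 ≤ 6 * D - 1` for `D ≥ 6`.
    have hexp : S + (m + 2) * (labelDrop k + 1) + 5 ≤ T + (6 * labelDrop k - 1) := by
      obtain h | ⟨n, rfl⟩ : m ≤ 2 ∨ ∃ n, m = n + 2 := by
        rcases le_total m 2 with h | h
        · exact Or.inl h
        · exact Or.inr ⟨m - 2, by omega⟩
      · have : (m + 2) * (labelDrop k + 1) ≤ 4 * (labelDrop k + 1) :=
          Nat.mul_le_mul_right _ (by omega)
        omega
      · rw [show I + 1 + (n + 2) - I - 3 = n by omega] at hrun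
        rw [show n + 2 + 2 = n + 4 by ring, add_mul]
        omega
    set t : ℝ := (1 / 2) ^ T with ht
    have ht0 : 0 < t := by positivity
    have ht1 : t ≤ 1 / 2 := by
      refine (pow_le_pow_of_le_one (by norm_num) (by norm_num) (show 1 ≤ T by omega)).trans ?_
      norm_num
    set z : ℝ := (1 / 2) ^ (S + (m + 2) * (labelDrop k + 1)) * 2 ^ (6 * labelDrop k - 1) with hz
    have hz32 : 32 * t ≤ z := by
      have h1 : (2 : ℝ) ^ (S + (m + 2) * (labelDrop k + 1) + 5) ≤
          2 ^ (T + (6 * labelDrop k - 1)) := pow_le_pow_right₀ (by norm_num) hexp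
      rw [pow_add _ (S + _) 5, pow_add _ T] at h1
      rw [hz, ht, one_div, inv_pow, inv_pow, inv_mul_eq_div, ← div_eq_mul_inv,
        div_le_div_iff₀ (by positivity) (by positivity)]
      linarith
    have hexp2 : Real.exp (-z) ≤ 1 / (1 + 32 * t) := by
      rw [Real.exp_neg, one_div]
      refine inv_anti₀ (by positivity) ?_
      linarith [Real.add_one_le_exp z]
    -- From `t ≤ 1 / 2` follows `32 * t / (1 + 32 * t) ≥ 32 * t / 17`; the surplus over `t`
    -- compensates for `1 - 4 * siteError k`.
    have hbig : 1.5 * t ≤ (quadrantLaw ν).real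
        (hasRowEvent k x y (blockSize k * I) (blockSize k * (I + 1 + m + 1)) J) := by
      refine le_trans ?_ hrow
      refine le_trans ?_ (sub_le_sub_left hexp2 1)
      rw [le_sub_iff_add_le, ← le_sub_iff_add_le', div_le_iff₀ (by positivity)]
      nlinarith
    refine le_trans ?_ (mul_le_mul_of_nonneg_left hbig (by linarith))
    have := bondError_pos (k + 1)
    nlinarith

end Quenched

/-! ### Percolation from the origin in the quadrant -/

section QuadrantPercolation

variable {ν : Measure Bool} [IsProbabilityMeasure ν]

/-- A deleted column is crossed by one extra horizontal edge, open with probability at least one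
half, and its label is at least 1. -/
lemma bondBound_zero (hν : 1 - bondError 0 ≤ ν.real {true}) : BondBound ν 0 := by
  intro x y _ _ i i' j hi _ _ _ hbad
  have hU0 := bondError_pos 0
  have hU1 : bondError 0 ≤ 1 / 2 := by
    unfold bondError labelDrop
    norm_num
  have hset : bondEvent 0 x y i i' j =
      Set.pi ((Finset.Ico i i').image fun t => (t, j, true) : Finset (ℕ × ℕ × Bool))
        fun _ => {true} := by
    ext ω
    simp only [bondEvent, Bond, hor, Set.mem_pi, Set.mem_ofPred_eq, Finset.coe_image,
      Set.mem_image, Finset.mem_coe, Finset.mem_Ico, Set.mem_singleton_iff]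
    constructor
    · rintro h _ ⟨t, ⟨h1, h2⟩, rfl⟩
      exact h t h1 h2
    · exact fun h t h1 h2 => h _ ⟨t, ⟨h1, h2⟩, rfl⟩
  have hinj : Function.Injective fun t : ℕ => (t, j, true) := fun a b h => by simpa using h
  have hprob : (quadrantLaw ν).real (bondEvent 0 x y i i' j) = ν.real {true} ^ (i' - i) := by
    rw [hset, measureReal_def, quadrantLaw, Measure.infinitePi_pi _ (by simp), Finset.prod_const,
      Finset.card_image_of_injective _ hinj, Nat.card_Ico, ENNReal.toReal_pow]
    rfl
  have hcost : i' - i - 1 ≤ ∑ t ∈ Finset.Ioo i i', crossCost 0 (x 0) t := by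
    calc i' - i - 1 = ∑ t ∈ Finset.Ioo i i', 1 := by simp
      _ ≤ _ := by
        refine Finset.sum_le_sum fun t ht => ?_
        have h1 := Finset.mem_Ioo.1 ht
        have h2 := hbad t h1.1 h1.2
        unfold crossCost
        omega
  obtain ⟨n, rfl⟩ : ∃ n, i' = i + 1 + n := ⟨i' - i - 1, by omega⟩
  rw [hprob, show i + 1 + n - i = n + 1 by omega, pow_succ']
  refine mul_le_mul hν ?_ (by positivity) measureReal_nonneg
  refine (pow_le_pow_of_le_one (by norm_num) (by norm_num)
    (show n ≤ _ from (by omega : n ≤ i + 1 + n - i - 1).trans hcost)).trans ?_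
  exact pow_le_pow_left₀ (by norm_num) (by linarith) n

lemma bondBound (hν : 1 - bondError 0 ≤ ν.real {true}) (k : ℕ) : BondBound ν k := by
  induction k with
  | zero => exact bondBound_zero hν
  | succ k ih => exact ih.succ

/-- The event that at scale `k` the first row is full over the first block and that this block
has a full row and a full column. -/
def originEvent (x y : ℕ → ℕ → ℕ) (k : ℕ) : Set (ℕ × ℕ × Bool → Bool) :=
  siteEvent k x y 0 0 ∩ rowEvent k x y 0 (blockSize k) 0

lemma one_sub_le_of_harris {s z c a b d : ℝ} (hs0 : 0 < s) (hs1 : s ≤ 1 / 100) (hc1 : c ≤ 1)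
    (hc0 : 0 < c) (ha : (1 - s) ^ 2 ≤ a) (hb : 1 - z ≤ b) (hd : a * b ≤ d)
    (hs : 5 * s ≤ 1 / 8 * c) (hz : z ≤ 1 / 8 * c) : 1 - d ≤ 1 / 4 * c := by
  have h1 : 1 - 1 / 20 * c ≤ a := by nlinarith
  have h2 : 1 - 1 / 8 * c ≤ b := by linarith
  have h3 := mul_le_mul h1 h2 (by linarith) (by linarith)
  nlinarith

/-- The initial block has no defects, so no cost arises and only bond and site errors remain. They
decay fast enough for a union bound over the scales. -/
lemma originEvent_bound {k : ℕ} (hk : BondBound ν k) {x y : ℕ → ℕ → ℕ} (hx : Hierarchical x)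
    (hy : Hierarchical y) (hx0 : ∀ k i, i < blockSize k → x k i = 0)
    (hy0 : ∀ k i, i < blockSize k → y k i = 0) :
    (quadrantLaw ν) (originEvent x y k)ᶜ ≤ ENNReal.ofReal (1 / 4 * (1 / 2) ^ k) := by
  have hpos : ∀ k, 0 < blockSize k := fun k => by have := two_le_blockSize k; omega
  have hs0 := siteError_pos k
  have hs1 := siteError_le k
  obtain ⟨F, hF⟩ := incrOn_exists_inter (siteEvent_incr k x y 0 0)
    ⟨_, rowEvent_incrOn k x y 0 (blockSize k) 0⟩
  have hmeas : MeasurableSet (originEvent x y k) := hF.localOn.measurableSet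
  have h1 := hk.site hx hy (hx0 (k + 1) 0 (hpos _)) (hy0 (k + 1) 0 (hpos _))
  have h2 := hk.row hx hy (hy0 k 0 (hpos _)) 0 (blockSize k)
  have hcost : ∑ t ∈ Finset.Ico 0 (0 + blockSize k), crossCost k (x k) t = 0 := by
    refine Finset.sum_eq_zero fun t ht => ?_
    have ht' := (Finset.mem_Ico.1 ht).2
    rw [zero_add] at ht'
    simp [crossCost, hx0 k t ht']
  rw [hcost, pow_zero, mul_one, zero_add] at h2
  have h3 := one_add_mul_le_pow (a := -bondError k) (by linarith [bondError_le_one k])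
    (blockSize k)
  have h4 : (blockSize k : ℝ) * bondError k = (1 / 2) ^ (2 * labelDrop k) := by
    unfold blockSize bondError
    push_cast
    rw [show 8 * labelDrop k = 6 * labelDrop k + 2 * labelDrop k by ring, pow_add, ← mul_assoc,
      ← mul_pow]
    norm_num
  rw [mul_neg, h4, ← sub_eq_add_neg, ← sub_eq_add_neg] at h3
  have h5 := harris_exists ν (siteEvent_incr k x y 0 0)
    ⟨_, rowEvent_incrOn k x y 0 (blockSize k) 0⟩
  have h6 := five_mul_siteError_le k
  have h7 : bondError (k + 1) ≤ 1 / 8 * (1 / 2) ^ k := by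
    calc bondError (k + 1) ≤ (1 / 2) ^ (3 + k) :=
          pow_le_pow_of_le_one (by norm_num) (by norm_num) (by unfold labelDrop; omega)
      _ = _ := by rw [pow_add]; norm_num
  have h8 : (1 / 2 : ℝ) ^ (2 * labelDrop k) ≤ 1 / 8 * (1 / 2) ^ k := by
    calc (1 / 2 : ℝ) ^ (2 * labelDrop k) ≤ (1 / 2) ^ (3 + k) :=
          pow_le_pow_of_le_one (by norm_num) (by norm_num) (by unfold labelDrop; omega)
      _ = _ := by rw [pow_add]; norm_num
  have h9 : (1 / 2 : ℝ) ^ k ≤ 1 := pow_le_one₀ (by norm_num) (by norm_num)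
  have h10 : (0 : ℝ) < (1 / 2) ^ k := by positivity
  rw [← ofReal_measureReal, probReal_compl_eq_one_sub hmeas]
  refine ENNReal.ofReal_le_ofReal ?_
  exact one_sub_le_of_harris hs0 hs1 h9 h10 h1 (h3.trans h2) h5 (by linarith) h8

/-- In a good environment, with probability at least one half the first row is full over the
first block at all scales. -/
theorem originEvents_bound (hν : 1 - bondError 0 ≤ ν.real {true}) {x y : ℕ → ℕ → ℕ}
    (hx : Hierarchical x) (hy : Hierarchical y)
    (hx0 : ∀ k i, i < blockSize k → x k i = 0) (hy0 : ∀ k i, i < blockSize k → y k i = 0) :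
    (quadrantLaw ν) (⋂ k, originEvent x y k)ᶜ ≤ ENNReal.ofReal (1 / 2) := by
  rw [Set.compl_iInter]
  refine (measure_iUnion_le _).trans ?_
  refine (ENNReal.tsum_le_tsum fun k => originEvent_bound (bondBound hν k) hx hy hx0 hy0).trans ?_
  rw [← ENNReal.ofReal_tsum_of_nonneg (fun k => by positivity)
    (summable_geometric_two.mul_left _), tsum_mul_left, tsum_geometric_two]
  norm_num

end QuadrantPercolation

/-! ### Transfer to the stretched lattice -/

section Lattice

/-- The edge of the square lattice that corresponds to an edge of the quadrant. -/
def quadrantEdge (e : ℕ × ℕ × Bool) : Sym2 (ℤ × ℤ) :=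
  s(((e.1 : ℤ), (e.2.1 : ℤ)),
    ((e.1 : ℤ), (e.2.1 : ℤ)) + if e.2.2 then ((1 : ℤ), (0 : ℤ)) else ((0 : ℤ), (1 : ℤ)))

lemma quadrantEdge_injective : Function.Injective quadrantEdge := by
  rintro ⟨a, b, c⟩ ⟨a', b', c'⟩ h
  simp only [quadrantEdge, Sym2.eq_iff, Prod.ext_iff] at h
  cases c <;> cases c' <;> simp at h ⊢ <;> omega

/-- A configuration of all pairs of vertices for which the edges of the quadrant satisfy the
origin events connects the origin to infinity. -/
lemma connectedToInfinity_of_originEvents {ηx ηy : ℤ → Bool} {x y : ℕ → ℕ → ℕ}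
    (hx : ∀ i : ℕ, x 0 i = 0 → ηx i = true) (hy : ∀ j : ℕ, y 0 j = 0 → ηy j = true)
    (hx0 : ∀ k i, i < blockSize k → x k i = 0) (hy0 : ∀ k i, i < blockSize k → y k i = 0)
    {ω : Sym2 (ℤ × ℤ) → Bool}
    (hω : (fun e => ω (quadrantEdge e)) ∈ ⋂ k, originEvent x y k) :
    ConnectedToInfinity (openGraph (stretchedLattice ηx ηy) fun e => ω e) (0, 0) := by
  set H := openGraph (stretchedLattice ηx ηy) fun e => ω e with hH
  set f : ℕ × ℕ → ℤ × ℤ := fun v => ((v.1 : ℤ), (v.2 : ℤ)) with hf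
  set ω' : ℕ × ℕ × Bool → Bool := fun e => ω (quadrantEdge e) with hω'
  have hC : Connects (fun v w => H.Reachable (f v) (f w)) x y (hor ω') (ver ω') := by
    refine ⟨⟨fun _ => SimpleGraph.Reachable.refl _, fun h => h.symm, fun h h' => h.trans h'⟩,
      fun i j hj ho => SimpleGraph.Adj.reachable ?_,
      fun i j hi ho => SimpleGraph.Adj.reachable ?_⟩
    · rw [hH, openGraph, SimpleGraph.fromEdgeSet_adj]
      refine ⟨⟨?_, ?_⟩, ?_⟩
      · rw [stretchedLattice, SimpleGraph.edgeSet_fromEdgeSet]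
        refine ⟨Or.inl ⟨f (i, j), hy j hj, ?_⟩, ?_⟩
        · simp [hf]
        · simp [hf]
      · simpa [hor, hω', quadrantEdge, hf] using ho
      · simp [hf]
    · rw [hH, openGraph, SimpleGraph.fromEdgeSet_adj]
      refine ⟨⟨?_, ?_⟩, ?_⟩
      · rw [stretchedLattice, SimpleGraph.edgeSet_fromEdgeSet]
        refine ⟨Or.inr ⟨f (i, j), hx i hi, ?_⟩, ?_⟩
        · simp [hf]
        · simp [hf]
      · simpa [ver, hω', quadrantEdge, hf] using ho
      · simp [hf]
  rw [Set.mem_iInter] at hω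
  have key := origin_conn hC hx0 hy0 (fun k => (hω k).1) (fun k => (hω k).2)
  refine Set.Infinite.of_image Prod.fst (Set.infinite_of_not_bddAbove ?_)
  rintro ⟨B, hB⟩
  obtain ⟨w, hw1, hw2⟩ := key B.toNat
  have h1 := hB ⟨f w, hw2, rfl⟩
  have h2 : B.toNat < 2 ^ B.toNat := Nat.lt_two_pow_self
  simp only [hf] at h1
  omega

/-- In a good environment the origin percolates with probability at least one half. -/
theorem bondPercolation_ge {ηx ηy : ℤ → Bool} {x y : ℕ → ℕ → ℕ} (hxh : Hierarchical x)
    (hyh : Hierarchical y)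
    (hx : ∀ i : ℕ, x 0 i = 0 → ηx i = true) (hy : ∀ j : ℕ, y 0 j = 0 → ηy j = true)
    (hx0 : ∀ k i, i < blockSize k → x k i = 0) (hy0 : ∀ k i, i < blockSize k → y k i = 0)
    {p : unitInterval} (hp : 1 - bondError 0 ≤ p) :
    ENNReal.ofReal (1 / 2) ≤ bondPercolation (stretchedLattice ηx ηy) p
      {ω | ConnectedToInfinity (openGraph (stretchedLattice ηx ηy) ω) (0, 0)} := by
  set ν := ProbabilityTheory.bernoulliMeasure true false p
  have hν : 1 - bondError 0 ≤ ν.real {true} := by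
    refine hp.trans (le_of_eq ?_)
    rw [ProbabilityTheory.bernoulliMeasure_real_apply p (by simp)]
    simp
  -- Coupling: independent values on all unordered pairs of vertices have the percolation on the
  -- stretched lattice and the one on the quadrant as marginals. Values on deleted edges are
  -- harmless.
  set μ : Measure (Sym2 (ℤ × ℤ) → Bool) := Measure.infinitePi fun _ => ν
  have h1 := Measure.map_infinitePi_infinitePi_of_inj (P := fun _ : Sym2 (ℤ × ℤ) => ν)
    (Subtype.val_injective (p := (· ∈ (stretchedLattice ηx ηy).edgeSet)))
  have h2 := Measure.map_infinitePi_infinitePi_of_inj (P := fun _ : Sym2 (ℤ × ℤ) => ν)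
    quadrantEdge_injective
  rw [bondPercolation]
  erw [← h1]
  refine le_trans ?_ (Measure.le_map_apply
    (measurable_pi_lambda _ fun _ => measurable_pi_apply _).aemeasurable _)
  set T := (fun (ω : Sym2 (ℤ × ℤ) → Bool) e => ω (quadrantEdge e)) ⁻¹' ⋂ k, originEvent x y k
    with hT
  have hsub : T ⊆ (fun (ω : Sym2 (ℤ × ℤ) → Bool)
      (i : (stretchedLattice ηx ηy).edgeSet) => ω i) ⁻¹'
      {ω | ConnectedToInfinity (openGraph (stretchedLattice ηx ηy) ω) (0, 0)} :=
    fun ω hω => connectedToInfinity_of_originEvents hx hy hx0 hy0 hω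
  refine le_trans ?_ (measure_mono hsub)
  have h3 : μ Tᶜ ≤ ENNReal.ofReal (1 / 2) := by
    refine le_trans ?_ (originEvents_bound hν hxh hyh hx0 hy0)
    rw [quadrantLaw, ← h2, hT, ← Set.preimage_compl]
    exact Measure.le_map_apply
      (measurable_pi_lambda _ fun _ => measurable_pi_apply _).aemeasurable _
  have h4 : (1 : ENNReal) ≤ μ T + μ Tᶜ := by
    rw [← measure_univ (μ := μ), ← Set.union_compl_self T]
    exact measure_union_le _ _
  have h5 : ENNReal.ofReal (1 / 2) + ENNReal.ofReal (1 / 2) ≤ μ T + ENNReal.ofReal (1 / 2) := by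
    rw [← ENNReal.ofReal_add (by norm_num) (by norm_num)]
    norm_num
    refine h4.trans (add_le_add_right (h3.trans (le_of_eq ?_)) _)
    norm_num
  exact (ENNReal.add_le_add_iff_right ENNReal.ofReal_ne_top).1 h5

end Lattice

/-! ### Exponential moments of the labels and good environments -/

section Environment

open scoped ENNReal

/-- The weight of a label: exponential on defects, zero on good blocks. -/
noncomputable def labelWeight (h : ℕ) : ℝ≥0∞ := if h = 0 then 0 else 2 ^ (14 * h)

lemma one_add_prod_le {ι : Type*} (s : Finset ι) (hs : s.Nonempty) (Y : ι → ℝ≥0∞) :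
    1 + ∏ i ∈ s, Y i ≤ ∏ i ∈ s, (1 + Y i) := by
  classical
  induction hs using Finset.Nonempty.cons_induction with
  | singleton a => simp
  | cons a s ha hs ih =>
    rw [Finset.prod_cons, Finset.prod_cons, add_mul, one_mul]
    refine add_le_add (le_trans le_self_add ih) ?_
    gcongr
    exact le_add_self

lemma one_add_sum_le_prod {ι : Type*} (s : Finset ι) (Y : ι → ℝ≥0∞) :
    1 + ∑ i ∈ s, Y i ≤ ∏ i ∈ s, (1 + Y i) := by
  classical
  induction s using Finset.cons_induction with
  | empty => simp
  | cons a s ha ih =>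
    rw [Finset.prod_cons, Finset.sum_cons, add_mul, one_mul, add_comm (Y a), ← add_assoc]
    refine add_le_add ih ?_
    exact le_mul_of_one_le_right' (le_trans le_self_add ih)

lemma one_add_sum_add_prod_le {ι : Type*} (s : Finset ι) (hs : 1 < s.card) (Y : ι → ℝ≥0∞) :
    1 + ∑ i ∈ s, Y i + ∏ i ∈ s, Y i ≤ ∏ i ∈ s, (1 + Y i) := by
  classical
  obtain ⟨a, ha, b, hb, hab⟩ := Finset.one_lt_card.1 hs
  have hne : (s.erase a).Nonempty := ⟨b, Finset.mem_erase.2 ⟨hab.symm, hb⟩⟩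
  rw [← Finset.mul_prod_erase s _ ha, ← Finset.mul_prod_erase s _ ha,
    ← Finset.add_sum_erase s _ ha]
  have h1 := one_add_sum_le_prod (s.erase a) Y
  have h2 := one_add_prod_le _ hne Y
  calc 1 + (Y a + ∑ i ∈ s.erase a, Y i) + Y a * ∏ i ∈ s.erase a, Y i
      = (1 + ∑ i ∈ s.erase a, Y i) + Y a * (1 + ∏ i ∈ s.erase a, Y i) := by ring
    _ ≤ ∏ i ∈ s.erase a, (1 + Y i) + Y a * ∏ i ∈ s.erase a, (1 + Y i) := by gcongr
    _ = _ := by ring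

/-- A lone defect is paid for by the damped sum on the right. Several defects give at most the
product of the inflated weights, a term of the expanded product distinct from `1` and the linear
terms. Keeping these on the left avoids subtraction in `ℝ≥0∞`. -/
lemma labelWeight_coarseLabel_le (k : ℕ) (h : Fin (blockSize k) → ℕ) :
    labelWeight (coarseLabel k h) + (1 + ∑ r, 2 ^ (14 * labelDrop k) * labelWeight (h r)) ≤
      ∑ r, (2⁻¹ : ℝ≥0∞) ^ (14 * labelDrop k) * labelWeight (h r) +
        ∏ r, (1 + 2 ^ (14 * labelDrop k) * labelWeight (h r)) := by
  set Y : Fin (blockSize k) → ℝ≥0∞ := fun r => 2 ^ (14 * labelDrop k) * labelWeight (h r) with hY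
  set B := Finset.univ.filter fun r => h r ≠ 0 with hB
  have hbad : ∀ r, h r ≠ 0 → Y r = 2 ^ (14 * (h r + labelDrop k)) := by
    intro r hr
    rw [hY]
    simp only [labelWeight, if_neg hr]
    rw [← pow_add]
    congr 1
    ring
  have hgood : ∀ r, r ∉ B → Y r = 0 := by
    intro r hr
    have : h r = 0 := by simpa [hB] using hr
    simp [hY, labelWeight, this]
  have hinv : ∀ n : ℕ, (2⁻¹ : ℝ≥0∞) ^ n * 2 ^ n = 1 := by
    intro n
    rw [← mul_pow, ENNReal.inv_mul_cancel (by norm_num) (by norm_num), one_pow]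
  by_cases hc : B.card ≤ 1
  · refine add_le_add ?_ (one_add_sum_le_prod _ Y)
    rw [coarseLabel, if_pos hc]
    by_cases h0 : (∑ r, h r) - labelDrop k = 0
    · simp [labelWeight, h0]
    · have hsum : ∑ r, h r ≠ 0 := by omega
      obtain ⟨a, -, ha⟩ := Finset.exists_ne_zero_of_sum_ne_zero hsum
      have hother : ∀ r ∈ Finset.univ, r ≠ a → h r = 0 := by
        intro r _ hra
        by_contra hr
        exact hra (Finset.card_le_one.1 hc r (by simpa [hB] using hr) a (by simpa [hB] using ha))
      rw [Finset.sum_eq_single_of_mem a (Finset.mem_univ _) hother] at h0 ⊢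
      refine le_trans ?_ (Finset.single_le_sum
        (f := fun r => (2⁻¹ : ℝ≥0∞) ^ (14 * labelDrop k) * labelWeight (h r))
        (fun _ _ => zero_le) (Finset.mem_univ a))
      simp only [labelWeight, if_neg h0, if_neg ha]
      rw [show 14 * h a = 14 * labelDrop k + 14 * (h a - labelDrop k) by omega, pow_add,
        ← mul_assoc, hinv, one_mul]
  · refine le_trans ?_ le_add_self
    rw [not_le] at hc
    have h1 := one_add_sum_add_prod_le B hc Y
    have e1 : ∑ i ∈ B, Y i = ∑ i, Y i :=
      Finset.sum_subset (Finset.subset_univ _) fun r _ hr => hgood r hr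
    have e2 : ∏ i ∈ B, (1 + Y i) = ∏ i, (1 + Y i) :=
      Finset.prod_subset (Finset.subset_univ _) fun r _ hr => by rw [hgood r hr, add_zero]
    have e3 : labelWeight (coarseLabel k h) ≤ ∏ i ∈ B, Y i := by
      have hcl : coarseLabel k h = ∑ r ∈ B, (h r + labelDrop k) := by
        rw [coarseLabel, if_neg (not_le.2 hc), hB, Finset.sum_filter]
        refine Finset.sum_congr rfl fun r _ => ?_
        by_cases hr : h r = 0 <;> simp [hr]
      have hp : ∏ i ∈ B, Y i = 2 ^ (14 * coarseLabel k h) := by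
        rw [hcl, Finset.mul_sum, ← Finset.prod_pow_eq_pow_sum]
        exact Finset.prod_congr rfl fun r hr => hbad r (by simpa [hB] using hr)
      rw [hp, labelWeight]
      split_ifs
      · exact zero_le
      · exact le_rfl
    rw [e1, e2] at h1
    rw [add_comm (labelWeight _)]
    exact (add_le_add_right e3 _).trans h1

lemma one_add_pow_le (N : ℕ) {y : ℝ≥0∞} (hy : N * y ≤ 1) :
    (1 + y) ^ N ≤ 1 + N * y + (N * y) ^ 2 := by
  rcases Nat.eq_zero_or_pos N with rfl | hN
  · simp
  have hyt : y ≠ ∞ := by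
    rintro rfl
    rw [ENNReal.mul_top (by simpa using hN.ne')] at hy
    simp at hy
  lift y to NNReal using hyt
  have hy' : (N : ℝ) * y ≤ 1 := by exact_mod_cast hy
  have h0 : (0 : ℝ) ≤ N * y := by positivity
  have h1 : (1 + (y : ℝ)) ^ N ≤ 1 + N * y + (N * y) ^ 2 := by
    have h2 : (1 + (y : ℝ)) ^ N ≤ Real.exp (N * y) := by
      rw [Real.exp_nat_mul]
      refine pow_le_pow_left₀ (by positivity) ?_ _
      linarith [Real.add_one_le_exp (y : ℝ)]
    have h3 := (abs_le.1 (Real.abs_exp_sub_one_sub_id_le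
      (show |(N : ℝ) * y| ≤ 1 by rwa [abs_of_nonneg h0]))).2
    linarith
  exact_mod_cast h1

/-- The labels of the blocks of the environment at all scales. -/
def envLabel (η : ℤ → Bool) : ℕ → ℕ → ℕ
  | 0, i => if η i then 0 else 1
  | k + 1, I => coarseLabel k fun r => envLabel η k (blockSize k * I + r)

lemma hierarchical_envLabel (η : ℤ → Bool) : Hierarchical (envLabel η) := fun _ _ => rfl

lemma measurable_envLabel (k i : ℕ) : Measurable fun η : ℤ → Bool => envLabel η k i := by
  induction k generalizing i with
  | zero =>
    have h : Measurable fun b : Bool => if b then (0 : ℕ) else 1 := measurable_of_countable _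
    exact h.comp (measurable_pi_apply (i : ℤ))
  | succ k ih =>
    have h : Measurable (coarseLabel k) := measurable_of_countable _
    exact h.comp (measurable_pi_lambda _ fun r => ih _)

lemma block_index_injective (N : ℕ) :
    Function.Injective fun q : ℕ × Fin N => N * q.1 + q.2 := by
  rintro ⟨a, r⟩ ⟨b, s⟩ h
  simp only at h
  have hr := r.2
  have hs := s.2
  have hN : 0 < N := by omega
  have h1 : a = b := by
    have := congrArg (· / N) h
    simpa [Nat.mul_add_div hN, Nat.div_eq_of_lt hr, Nat.div_eq_of_lt hs] using this
  subst h1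
  have h2 : r = s := Fin.ext (by omega)
  rw [h2]

/-- Coarse-graining a sequence of independent labels with the law `m`. -/
lemma map_blocks {N : ℕ} {F : (Fin N → ℕ) → ℕ} (hF : Measurable F) (m : Measure ℕ)
    [IsProbabilityMeasure m] :
    (Measure.infinitePi fun _ : ℕ => m).map (fun h I => F fun r => h (N * I + r)) =
      Measure.infinitePi fun _ : ℕ => (Measure.infinitePi fun _ : Fin N => m).map F := by
  rw [← Measure.infinitePi_map_pi (μ := fun _ : ℕ =>
    Measure.infinitePi fun _ : Fin N => m) (f := fun _ => F) (fun _ => hF)]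
  rw [← Measure.infinitePi_map_curry (μ := fun (_ : ℕ) (_ : Fin N) => m)]
  have h := Measure.map_infinitePi_infinitePi_of_inj (P := fun _ : ℕ => m)
    (block_index_injective N)
  rw [← h, Measure.map_map (by fun_prop) (by fun_prop), Measure.map_map (by fun_prop) (by fun_prop)]
  rfl

/-- In expectation, independence turns the product into `(1 + y) ^ N`; cancelling `1 + N * y` leaves
a linear term with the factor `2 ^ (-14 * D)` and the square `(N * y) ^ 2`. -/
lemma labelWeight_moment_succ {k : ℕ} {m : Measure ℕ} [IsProbabilityMeasure m]
    (hm : ∫⁻ h, labelWeight h ∂m ≤ 2⁻¹ ^ (47 * labelDrop k + 6)) :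
    ∫⁻ h, labelWeight h ∂((Measure.infinitePi fun _ : Fin (blockSize k) => m).map
      (coarseLabel k)) ≤ 2⁻¹ ^ (47 * labelDrop (k + 1) + 6) := by
  have hD : 6 ≤ labelDrop k := by unfold labelDrop; omega
  have hD' : labelDrop (k + 1) = labelDrop k + 1 := by unfold labelDrop; omega
  have hF : Measurable (coarseLabel k) := measurable_of_countable _
  have hw : Measurable labelWeight := measurable_of_countable _
  set M := Measure.infinitePi fun _ : Fin (blockSize k) => m with hM
  set e := ∫⁻ h, labelWeight h ∂m with he
  set D := labelDrop k
  have hinv : ∀ a b : ℕ, (2 : ℝ≥0∞) ^ a * 2⁻¹ ^ (a + b) = 2⁻¹ ^ b := by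
    intro a b
    rw [pow_add, ← mul_assoc, ← mul_pow, ENNReal.mul_inv_cancel (by norm_num) (by norm_num),
      one_pow, one_mul]
  have heval : ∀ r : Fin (blockSize k), ∫⁻ h, labelWeight (h r) ∂M = e := by
    intro r
    rw [he, ← Measure.infinitePi_map_eval (fun _ : Fin (blockSize k) => m) r,
      lintegral_map hw (measurable_pi_apply r)]
  have hY : Measurable fun h : ℕ => 1 + 2 ^ (14 * D) * labelWeight h := measurable_of_countable _
  have hprod : ∫⁻ h, ∏ r, (1 + 2 ^ (14 * D) * labelWeight (h r)) ∂M =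
      (1 + 2 ^ (14 * D) * e) ^ blockSize k := by
    rw [ProbabilityTheory.lintegral_prod_eq_prod_lintegral_of_indepFun (μ := M) Finset.univ
      (fun r (h : Fin (blockSize k) → ℕ) => 1 + 2 ^ (14 * D) * labelWeight (h r))
      (ProbabilityTheory.iIndepFun_infinitePi (P := fun _ : Fin (blockSize k) => m)
        (X := fun _ h => 1 + 2 ^ (14 * D) * labelWeight h) fun _ => hY)
      (fun r => hY.comp (measurable_pi_apply r))]
    have : ∀ r : Fin (blockSize k), ∫⁻ h, (1 + 2 ^ (14 * D) * labelWeight (h r)) ∂M =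
        1 + 2 ^ (14 * D) * e := by
      intro r
      have hwr : Measurable fun h : Fin (blockSize k) → ℕ => labelWeight (h r) :=
        hw.comp (measurable_pi_apply r)
      rw [lintegral_add_left measurable_const, lintegral_const_mul _ hwr, heval]
      simp
    rw [Finset.prod_congr rfl fun r _ => this r]
    simp
  have hsum : ∀ c : ℝ≥0∞, ∫⁻ h, ∑ r, c * labelWeight (h r) ∂M = blockSize k * (c * e) := by
    intro c
    have hwr : ∀ r : Fin (blockSize k), Measurable fun h : Fin (blockSize k) → ℕ =>
        labelWeight (h r) := fun r => hw.comp (measurable_pi_apply r)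
    rw [lintegral_finsetSum _ fun r _ => (hwr r).const_mul c,
      Finset.sum_congr rfl fun r _ => (lintegral_const_mul c (hwr r)).trans (by rw [heval])]
    simp
  have key : ∫⁻ h, labelWeight (coarseLabel k h) ∂M +
      (1 + blockSize k * (2 ^ (14 * D) * e)) ≤
      blockSize k * (2⁻¹ ^ (14 * D) * e) + (1 + 2 ^ (14 * D) * e) ^ blockSize k := by
    have h1 := lintegral_mono (μ := M) fun h => labelWeight_coarseLabel_le k h
    have hwr : ∀ (c : ℝ≥0∞), Measurable fun h : Fin (blockSize k) → ℕ =>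
        ∑ r, c * labelWeight (h r) :=
      fun c => Finset.measurable_sum _ fun r _ => (hw.comp (measurable_pi_apply r)).const_mul c
    have hwF : Measurable fun h => labelWeight (coarseLabel k h) := hw.comp hF
    rw [lintegral_add_left hwF, lintegral_add_left measurable_const,
      lintegral_add_left (hwr _), hprod, hsum, hsum, lintegral_one, measure_univ] at h1
    exact h1
  have hN : (blockSize k : ℝ≥0∞) = 2 ^ (6 * D) := by
    rw [blockSize]
    push_cast
    rfl
  have hNy : blockSize k * (2 ^ (14 * D) * e) ≤ 2⁻¹ ^ (27 * D + 6) := by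
    calc blockSize k * (2 ^ (14 * D) * e)
        ≤ 2 ^ (6 * D) * (2 ^ (14 * D) * 2⁻¹ ^ (14 * D + (6 * D + (27 * D + 6)))) := by
          rw [show 14 * D + (6 * D + (27 * D + 6)) = 47 * D + 6 by ring]
          gcongr
          exact hN.le
      _ = _ := by rw [hinv, hinv]
  have hhalf : (2⁻¹ : ℝ≥0∞) ≤ 1 := by simp
  have hNy1 : blockSize k * (2 ^ (14 * D) * e) ≤ 1 := hNy.trans (pow_le_one₀ (zero_le) hhalf)
  have h2 := key.trans (add_le_add_right (one_add_pow_le (blockSize k) hNy1) _)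
  have hfin : 1 + blockSize k * (2 ^ (14 * D) * e) ≠ ∞ :=
    ENNReal.add_ne_top.2 ⟨by simp, ne_top_of_le_ne_top (by simp) hNy1⟩
  have h3 : ∫⁻ h, labelWeight (coarseLabel k h) ∂M ≤
      blockSize k * (2⁻¹ ^ (14 * D) * e) + (blockSize k * (2 ^ (14 * D) * e)) ^ 2 := by
    refine (ENNReal.add_le_add_iff_right hfin).1 (h2.trans (le_of_eq ?_))
    ring
  rw [lintegral_map hw hF]
  refine h3.trans ?_
  -- Each of the two terms is at most half of the target. Both exponent comparisons, `55 * D + 6`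
  -- and `54 * D + 12` against `47 * D + 54`, are equalities at `D = 6`, the value at scale 0.
  have h4 : blockSize k * (2⁻¹ ^ (14 * D) * e) ≤ 2⁻¹ ^ (47 * (D + 1) + 7) := by
    calc blockSize k * (2⁻¹ ^ (14 * D) * e)
        ≤ 2 ^ (6 * D) * (2⁻¹ ^ (14 * D) * 2⁻¹ ^ (47 * D + 6)) := by
          gcongr
          exact hN.le
      _ = 2 ^ (6 * D) * 2⁻¹ ^ (6 * D + (55 * D + 6)) := by
          rw [← pow_add, show 14 * D + (47 * D + 6) = 6 * D + (55 * D + 6) by ring]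
      _ = 2⁻¹ ^ (55 * D + 6) := hinv _ _
      _ ≤ _ := pow_le_pow_of_le_one (zero_le) hhalf (by omega)
  have h5 : (blockSize k * (2 ^ (14 * D) * e)) ^ 2 ≤ 2⁻¹ ^ (47 * (D + 1) + 7) := by
    calc (blockSize k * (2 ^ (14 * D) * e)) ^ 2 ≤ (2⁻¹ ^ (27 * D + 6)) ^ 2 := by gcongr
      _ ≤ _ := by
        rw [← pow_mul]
        exact pow_le_pow_of_le_one (zero_le) hhalf (by omega)
  refine (add_le_add h4 h5).trans (le_of_eq ?_)
  rw [hD', ← two_mul, show 47 * (D + 1) + 7 = 1 + (47 * (D + 1) + 6) by ring]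
  simpa using hinv 1 (47 * (D + 1) + 6)

/-- The labels of each scale are independent with the same law, whose exponential moment on
defects is small. -/
theorem envLabel_law {ρ : unitInterval} (hρ : 2 ^ 14 * ENNReal.ofReal ρ ≤ 2⁻¹ ^ 288) (k : ℕ) :
    ∃ m : Measure ℕ, IsProbabilityMeasure m ∧
      (lineLaw ρ).map (fun η i => envLabel η k i) = Measure.infinitePi (fun _ : ℕ => m) ∧
      ∫⁻ h, labelWeight h ∂m ≤ 2⁻¹ ^ (47 * labelDrop k + 6) := by
  have hw : Measurable labelWeight := measurable_of_countable _
  induction k with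
  | zero =>
    set ν := ProbabilityTheory.bernoulliMeasure false true ρ with hν
    have hg : Measurable fun b : Bool => if b then (0 : ℕ) else 1 := measurable_of_countable _
    refine ⟨ν.map fun b => if b then (0 : ℕ) else 1, Measure.isProbabilityMeasure_map hg.aemeasurable,
      ?_, ?_⟩
    · rw [← Measure.infinitePi_map_pi (μ := fun _ : ℕ => ν) (fun _ => hg)]
      have h := Measure.map_infinitePi_infinitePi_of_inj (P := fun _ : ℤ => ν)
        (f := fun i : ℕ => (i : ℤ)) Nat.cast_injective
      have hm1 : Measurable fun (ω : ℕ → Bool) (i : ℕ) => if ω i then (0 : ℕ) else 1 :=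
        measurable_pi_lambda _ fun i => hg.comp (measurable_pi_apply i)
      rw [← h, Measure.map_map hm1
        (measurable_pi_lambda _ fun i => measurable_pi_apply _)]
      rfl
    · rw [lintegral_map hw hg, hν, ProbabilityTheory.bernoulliMeasure_def, lintegral_add_measure,
        lintegral_smul_measure, lintegral_smul_measure, lintegral_dirac, lintegral_dirac]
      refine le_trans (le_of_eq ?_) hρ
      rw [ENNReal.ofReal, mul_comm]
      simp only [labelWeight, Bool.false_eq_true, if_false, if_true, smul_zero, add_zero,
        one_ne_zero, mul_one, ENNReal.smul_def, smul_eq_mul]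
      rw [Real.toNNReal_of_nonneg ρ.2.1]
      rfl
  | succ k ih =>
    obtain ⟨m, hm, h1, h2⟩ := ih
    have hF : Measurable (coarseLabel k) := measurable_of_countable _
    refine ⟨_, Measure.isProbabilityMeasure_map hF.aemeasurable, ?_, labelWeight_moment_succ h2⟩
    have hm1 : Measurable fun (h : ℕ → ℕ) I => coarseLabel k fun r => h (blockSize k * I + r) :=
      measurable_pi_lambda _ fun I =>
        hF.comp (measurable_pi_lambda _ fun r => measurable_pi_apply _)
    have hm2 : Measurable fun (η : ℤ → Bool) i => envLabel η k i :=
      measurable_pi_lambda _ fun i => measurable_envLabel k i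
    rw [← map_blocks hF, ← h1, Measure.map_map hm1 hm2]
    rfl

/-- The environments of a line whose initial blocks are good at all scales. -/
def goodLines : Set (ℤ → Bool) := {η | ∀ k i, i < blockSize k → envLabel η k i = 0}

lemma goodLines_eq : goodLines = ⋂ k, ⋂ i ∈ Set.Iio (blockSize k), {η | envLabel η k i = 0} := by
  ext η
  simp [goodLines]

lemma measurableSet_goodLines : MeasurableSet goodLines := by
  rw [goodLines_eq]
  refine MeasurableSet.iInter fun k => MeasurableSet.biInter (Set.to_countable _) fun i _ => ?_
  exact measurable_envLabel k i (measurableSet_singleton 0)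

instance (ρ : unitInterval) : IsProbabilityMeasure (lineLaw ρ) := by
  unfold lineLaw; infer_instance

lemma lineLaw_defect_le {ρ : unitInterval} (hρ : 2 ^ 14 * ENNReal.ofReal ρ ≤ 2⁻¹ ^ 288)
    (k i : ℕ) : lineLaw ρ {η | envLabel η k i ≠ 0} ≤ 2⁻¹ ^ (47 * labelDrop k + 6) := by
  obtain ⟨m, hm, h1, h2⟩ := envLabel_law hρ k
  refine le_trans ?_ h2
  have hmeas : Measurable fun (η : ℤ → Bool) i => envLabel η k i :=
    measurable_pi_lambda _ fun i => measurable_envLabel k i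
  have e1 : lineLaw ρ {η | envLabel η k i ≠ 0} = m {h | h ≠ 0} := by
    rw [← Measure.infinitePi_map_eval (fun _ : ℕ => m) i, ← h1,
      Measure.map_map (measurable_pi_apply i) hmeas,
      Measure.map_apply ((measurable_pi_apply i).comp hmeas) (Set.to_countable _).measurableSet]
    rfl
  rw [e1, ← lintegral_indicator_one (Set.to_countable _).measurableSet]
  refine lintegral_mono fun h => ?_
  by_cases hh : h = 0
  · simp [hh]
  · rw [Set.indicator_of_mem (by simpa using hh), labelWeight, if_neg hh]
    exact one_le_pow₀ (by norm_num)

/-- A union bound over the `2 ^ (6 * D)` initial labels of each scale leaves `2 ^ (-(41 * D + 6))`,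
whose sum over the scales is at most one half. -/
lemma lineLaw_goodLines_pos {ρ : unitInterval} (hρ : 2 ^ 14 * ENNReal.ofReal ρ ≤ 2⁻¹ ^ 288) :
    0 < lineLaw ρ goodLines := by
  have hhalf : (2⁻¹ : ℝ≥0∞) ≤ 1 := by simp
  have hc : lineLaw ρ goodLinesᶜ ≤ 2⁻¹ := by
    have hsub : goodLinesᶜ ⊆ ⋃ k, ⋃ i ∈ Finset.range (blockSize k),
        {η | envLabel η k i ≠ 0} := by
      intro η hη
      simpa [goodLines] using hη
    refine (measure_mono hsub).trans ((measure_iUnion_le _).trans ?_)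
    have hk : ∀ k, lineLaw ρ (⋃ i ∈ Finset.range (blockSize k), {η | envLabel η k i ≠ 0}) ≤
        2⁻¹ ^ 2 * 2⁻¹ ^ k := by
      intro k
      refine (measure_biUnion_finset_le _ _).trans ?_
      refine (Finset.sum_le_sum fun i _ => lineLaw_defect_le hρ k i).trans ?_
      rw [Finset.sum_const, Finset.card_range, nsmul_eq_mul, blockSize, Nat.cast_pow,
        show 47 * labelDrop k + 6 = 6 * labelDrop k + (41 * labelDrop k + 6) by ring, pow_add,
        ← mul_assoc, ← mul_pow, Nat.cast_ofNat,
        ENNReal.mul_inv_cancel (by norm_num) (by norm_num), one_pow, one_mul, ← pow_add]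
      exact pow_le_pow_of_le_one (zero_le) hhalf (by unfold labelDrop; omega)
    refine (ENNReal.tsum_le_tsum hk).trans ?_
    rw [ENNReal.tsum_mul_left, ENNReal.tsum_geometric, ENNReal.one_sub_inv_two, inv_inv, pow_two,
      mul_assoc, ENNReal.inv_mul_cancel (by norm_num) (by norm_num), mul_one]
  rw [pos_iff_ne_zero]
  intro h0
  rw [prob_compl_eq_one_sub measurableSet_goodLines, h0] at hc
  norm_num at hc

end Environment

/-! ### Numerical conditions and conclusion -/

theorem theorem1p1 (L : ℝ) (hL : L = 10 ^ 6) (ρ p : unitInterval)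
    (hρ : (ρ : ℝ) ≤ L ^ (-16 : ℤ))
    (hp : (1 - L ^ (-10 : ℤ)) ^ (1 / 4 : ℝ) ≤ (p : ℝ)) :
    0 < annealedPercolationProb ρ p := by
  -- A defect of scale 0 has weight `2 ^ 14`, and `288 = 47 * 6 + 6` is the moment exponent at scale
  -- 0; `10 ^ 6 ≥ 2 ^ 19` gives enough room.
  have hρ' : 2 ^ 14 * ENNReal.ofReal ρ ≤ 2⁻¹ ^ 288 := by
    have h1 : ENNReal.ofReal ρ ≤ ENNReal.ofReal ((1 / 2) ^ 302) := by
      refine ENNReal.ofReal_le_ofReal (hρ.trans ?_)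
      rw [hL, one_div, inv_pow, zpow_neg]
      refine inv_anti₀ (by positivity) ?_
      calc (2 : ℝ) ^ 302 ≤ 2 ^ (19 * 16) := pow_le_pow_right₀ (by norm_num) (by norm_num)
        _ = (2 ^ 19) ^ 16 := pow_mul _ _ _
        _ ≤ (10 ^ 6) ^ 16 := pow_le_pow_left₀ (by norm_num) (by norm_num) _
        _ = _ := by norm_cast
    have h2 : ENNReal.ofReal ((1 / 2) ^ 302) = 2⁻¹ ^ 302 := by
      rw [ENNReal.ofReal_pow (by norm_num), one_div, ENNReal.ofReal_inv_of_pos (by norm_num)]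
      norm_num
    rw [h2] at h1
    refine (mul_le_mul_right h1 _).trans (le_of_eq ?_)
    rw [show 302 = 14 + 288 by norm_num, pow_add, ← mul_assoc, ← mul_pow,
      ENNReal.mul_inv_cancel (by norm_num) (by norm_num), one_pow, one_mul]
  have hp' : 1 - bondError 0 ≤ p := by
    refine le_trans ?_ hp
    rw [hL]
    -- The fourth root only increases a number in `[0, 1]`, and `10 ^ (-60) ≤ 2 ^ (-48) = bondError
    -- 0`.
    refine le_trans ?_ (Real.self_le_rpow_of_le_one (by norm_num) (by norm_num) (by norm_num))
    unfold bondError labelDrop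
    norm_num
  have hle : ∫⁻ _ in goodLines ×ˢ goodLines, ENNReal.ofReal (1 / 2) ∂(environmentLaw ρ) ≤
      annealedPercolationProb ρ p := by
    refine le_trans ?_ (setLIntegral_le_lintegral (goodLines ×ˢ goodLines) _)
    refine setLIntegral_mono' (measurableSet_goodLines.prod measurableSet_goodLines) fun η hη => ?_
    have h0 : ∀ (η : ℤ → Bool) (i : ℕ), envLabel η 0 i = 0 → η i = true := by
      intro η i h
      by_contra hne
      simp [envLabel, hne] at h
    exact bondPercolation_ge (hierarchical_envLabel η.1) (hierarchical_envLabel η.2) (h0 _) (h0 _)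
      hη.1 hη.2 hp'
  refine lt_of_lt_of_le ?_ hle
  rw [setLIntegral_const, environmentLaw, Measure.prod_prod]
  have h := lineLaw_goodLines_pos hρ'
  exact ENNReal.mul_pos (by norm_num) (ENNReal.mul_pos h.ne' h.ne').ne'
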